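/- **Setting.** Fix an infinite set of propositional atoms. A *rule* $r$ has the form $a_1\vee\dots\vee a_m\leftarrow a_{m+1},\dots,a_n,\neg a_{n+1},\dots,\neg a_o$ with $0\le m\le n\le o$ and pairwise distinct atoms $a_i$; put $H_r=\{a_1,\dots,a_m\}$, $B_r^+=\{a_{m+1},\dots,a_n\}$, $B_r^-=\{a_{n+1},\dots,a_o\}$ and $\mathrm{at}(r)=H_r\cup B_r^+\cup B_r^-$. A *program* $\Pi$ is a finite set of rules, and $\mathrm{at}(\Pi)=\bigcup_{r\in\Pi}\mathrm{at}(r)$. A set $I$ of atoms satisfies $r$ if $(H_r\cup B_r^-)\cap I\neq\emptyset$ or $B_r^+\setminus I\neq\emptyset$; it is an *answer set* of $\Pi$ if it is a $\subseteq$-minimal model of the Gelfond–Lifschitz reduct $\Pi^I$ (remove the rules with $B_r^-\cap I\ne\emptyset$, then delete all negative bodies). The *positive dependency digraph* $D_\Pi$ has vertex set $\bigcup_{r\in\Pi}(H_r\cup B_r^+)$ and an edge from $a$ to $b$ whenever $a\in B_r^+$ and $b\in H_r$ for some $r\in\Pi$. $\Pi$ is *tight* if $D_\Pi$ has no directed cycle,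 and *head-cycle-free* if no directed cycle of $D_\Pi$ (a directed walk of positive length from a vertex to itself) contains two distinct atoms of the head of one rule. The *primal graph* $G_\Pi$ has vertex set $\mathrm{at}(\Pi)$, and two distinct atoms are adjacent if they occur together in some rule. Treewidth is the minimum over all tree decompositions of the maximal bag size minus one. **Theorem (Removing cyclicity of SCC-bounded ASP).** There is an absolute constant $c$ such that the following holds for all $k,\ell\in\mathbb N$. Let $\Pi$ be a head-cycle-free program such that $G_\Pi$ has treewidth at most $k$ and every strongly connected component $C$ of $D_\Pi$ satisfies $|C|+1\le\ell$. Then there is a tight program $\Pi'$ whose primal graph has treewidth at most $c\cdot k\cdot\log_2\ell$ (where $\log_2 0$ is read as $0$), such that the answer sets of $\Pi'$ projected to $\mathrm{at}(\Pi)$ are exactly the answer sets of $\Pi$, in a one-to-one manner: the map $I'\mapsto I'\cap\mathrm{at}(\Pi)$ is a bijection from the set of answer sets of $\Pi'$ onto the set of answer sets of $\Pi$. -/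

import Mathlib

/-- A rule `a₁ ∨ ⋯ ∨ aₘ ← aₘ₊₁, …, aₙ, ¬aₙ₊₁, …, ¬aₒ` over pairwise distinct atoms, given by its
head `{a₁, …, aₘ}`, positive body `{aₘ₊₁, …, aₙ}` and negative body `{aₙ₊₁, …, aₒ}`
(each of which may be empty). -/
@[ext]
structure Rule (α : Type*) where
  head : Finset α
  pos : Finset α
  neg : Finset α
  head_pos : Disjoint head pos
  head_neg : Disjoint head neg
  pos_neg : Disjoint pos neg

/-- A logic program is a set of rules (finiteness is stated separately). -/
abbrev Program (α : Type*) := Set (Rule α)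

/-- The atoms occurring in a rule. -/
def Rule.atoms {α : Type*} (r : Rule α) : Set α :=
  (r.head : Set α) ∪ (r.pos : Set α) ∪ (r.neg : Set α)

/-- An interpretation `I` (a set of atoms) satisfies a rule if it contains an atom of the head or
of the negative body, or misses an atom of the positive body. -/
def Rule.Satisfied {α : Type*} (I : Set α) (r : Rule α) : Prop :=
  (((r.head : Set α) ∪ (r.neg : Set α)) ∩ I).Nonempty ∨ ((r.pos : Set α) \ I).Nonempty

namespace Program

/-- The atoms `at(P)` occurring in a program. -/
def atoms {α : Type*} (P : Program α) : Set α := ⋃ r ∈ P, r.atoms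

def IsModel {α : Type*} (P : Program α) (I : Set α) : Prop :=
  ∀ r ∈ P, r.Satisfied I

/-- The Gelfond–Lifschitz reduct of `P` under `I`: rules whose negative body meets `I` are removed,
and the negative bodies of the remaining rules are deleted. -/
def reduct {α : Type*} (P : Program α) (I : Set α) : Program α :=
  {r' | ∃ r ∈ P, (r.neg : Set α) ∩ I = ∅ ∧ r'.head = r.head ∧ r'.pos = r.pos ∧ r'.neg = ∅}

/-- `I` is an answer set (stable model) of `P` if it is a `⊆`-minimal model of the reduct of `P`
under `I`. -/
def IsAnswerSet {α : Type*} (P : Program α) (I : Set α) : Prop :=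
  Minimal (fun J : Set α => (P.reduct I).IsModel J) I

/-- Vertices of the positive dependency digraph. -/
def depVertices {α : Type*} (P : Program α) : Set α :=
  ⋃ r ∈ P, ((r.head : Set α) ∪ (r.pos : Set α))

/-- Edges of the positive dependency digraph: from `a` to `b` if some rule has `a` in its positive
body and `b` in its head. -/
def DepEdge {α : Type*} (P : Program α) (a b : α) : Prop :=
  ∃ r ∈ P, a ∈ r.pos ∧ b ∈ r.head

/-- There is a directed path with at least one edge from `a` to `b` in the positive dependency
digraph. -/
def DepPath {α : Type*} (P : Program α) (a b : α) : Prop :=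
  Relation.TransGen P.DepEdge a b

/-- A strongly connected component of the positive dependency digraph: a non-empty `⊆`-largest
set of vertices in which there is a directed path between any two distinct vertices. -/
def IsSCC {α : Type*} (P : Program α) (C : Set α) : Prop :=
  C.Nonempty ∧ Maximal (fun C : Set α => C ⊆ P.depVertices ∧
    ∀ u ∈ C, ∀ v ∈ C, u ≠ v → P.DepPath u v) C

/-- Tight: the positive dependency digraph has no directed cycle. -/
def IsTight {α : Type*} (P : Program α) : Prop :=
  ∀ a, ¬ P.DepPath a a

/-- Head-cycle-free: no directed cycle of the positive dependency digraph (a directed walk from a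
vertex back to itself) contains two distinct atoms of the head of one rule. -/
def IsHCF {α : Type*} (P : Program α) : Prop :=
  ∀ r ∈ P, ∀ a ∈ r.head, ∀ b ∈ r.head, a ≠ b → ¬ (P.DepPath a b ∧ P.DepPath b a)

/-- The primal graph: its vertices are the atoms of `P`, and two distinct atoms are adjacent if
they occur together in some rule. -/
def primalGraph {α : Type*} (P : Program α) : SimpleGraph P.atoms where
  Adj a b := a ≠ b ∧ ∃ r ∈ P, (a : α) ∈ r.atoms ∧ (b : α) ∈ r.atoms
  symm := ⟨fun _ _ ⟨h, r, hr, ha, hb⟩ => ⟨h.symm, r, hr, hb, ha⟩⟩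
  loopless := ⟨fun _ h => h.1 rfl⟩

end Program

/-- A tree decomposition of a graph, over a finite rooted tree. -/
structure TreeDecomposition {V : Type*} (G : SimpleGraph V) where
  Node : Type
  [fintypeNode : Fintype Node]
  tree : SimpleGraph Node
  isTree : tree.IsTree
  root : Node
  bag : Node → Finset V
  cover : ∀ v, ∃ t, v ∈ bag t
  cover_edge : ∀ u v, G.Adj u v → ∃ t, u ∈ bag t ∧ v ∈ bag t
  connected : ∀ (r s t : Node) (p : tree.Walk r t), p.IsPath → s ∈ p.support →
    ∀ v, v ∈ bag r → v ∈ bag t → v ∈ bag s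

/-- The maximal size of a bag minus one (an integer: it is `-1` if all bags are empty). -/
def TreeDecomposition.width {V : Type*} {G : SimpleGraph V} (D : TreeDecomposition G) : ℤ :=
  letI := D.fintypeNode
  ((Finset.univ.sup fun t => (D.bag t).card : ℕ) : ℤ) - 1

/-- The minimum width of a tree decomposition of `G`. (For finite `G` the set of widths is
non-empty, and it is bounded below by `-1`.) -/
noncomputable def treewidth {V : Type*} (G : SimpleGraph V) : ℤ :=
  sInf {w : ℤ | ∃ D : TreeDecomposition G, D.width = w}

/-- A rooted tree presented by its parent function; `parent root` is irrelevant, and the rank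
decreases from every other node to its parent. -/
structure ParentTree (N : Type) where
  root : N
  parent : N → N
  rank : N → ℕ
  rank_parent_lt : ∀ t, t ≠ root → rank (parent t) < rank t

/-! ### Rooted trees, their decompositions, and binarisation. -/

namespace ParentTree

variable {N : Type} {V : Type*}

/-- The nodes whose bag contains a fixed vertex form a subtree: it has a top node, and every
other such node has a parent whose bag contains the vertex. -/
def IsDecomposition (T : ParentTree N) (bag : N → Finset V) : Prop :=
  ∀ v t, v ∈ bag t → ∃ τ, v ∈ bag τ ∧
    ∀ s, v ∈ bag s → s ≠ τ → s ≠ T.root ∧ v ∈ bag (T.parent s)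

/-- The children of a node. -/
def children (T : ParentTree N) (t : N) : Set N := {c | c ≠ T.root ∧ T.parent c = t}

/-- The undirected graph of a rooted tree. -/
def graph (T : ParentTree N) : SimpleGraph N :=
  SimpleGraph.fromRel fun s t => s ≠ T.root ∧ T.parent s = t

theorem parent_ne (T : ParentTree N) {t : N} (ht : t ≠ T.root) : T.parent t ≠ t := fun h => by
  have := T.rank_parent_lt t ht
  rw [h] at this
  exact lt_irrefl _ this

theorem adj_parent (T : ParentTree N) {t : N} (ht : t ≠ T.root) : T.graph.Adj t (T.parent t) := by
  rw [graph, SimpleGraph.fromRel_adj]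
  exact ⟨(T.parent_ne ht).symm, Or.inl ⟨ht, rfl⟩⟩

/-- Induction from the root downwards. -/
theorem induction_down (T : ParentTree N) {p : N → Prop}
    (h : ∀ t, (t ≠ T.root → p (T.parent t)) → p t) (t : N) : p t := by
  induction hn : T.rank t using Nat.strong_induction_on generalizing t with
  | _ n ih => exact h t fun ht => ih _ (hn ▸ T.rank_parent_lt t ht) _ rfl

/-- Induction from the leaves upwards. -/
theorem induction_up [Finite N] (T : ParentTree N) {p : N → Prop}
    (h : ∀ t, (∀ c ∈ T.children t, p c) → p t) (t : N) : p t := by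
  obtain ⟨M, hM⟩ := (Set.finite_range T.rank).bddAbove
  have hM' : ∀ t, T.rank t ≤ M := fun t => hM ⟨t, rfl⟩
  induction hn : M - T.rank t using Nat.strong_induction_on generalizing t with
  | _ n ih =>
    refine h t fun c hc => ih _ ?_ c rfl
    have h1 := T.rank_parent_lt c hc.1
    rw [hc.2] at h1
    have := hM' c
    omega

theorem reachable_root (T : ParentTree N) (t : N) : T.graph.Reachable t T.root := by
  induction t using T.induction_down with
  | _ t ih =>
    by_cases ht : t = T.root
    · rw [ht]
    · exact (T.adj_parent ht).reachable.trans (ih ht)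

theorem graph_connected (T : ParentTree N) : T.graph.Connected :=
  have : Nonempty N := ⟨T.root⟩
  ⟨fun s t => (T.reachable_root s).trans (T.reachable_root t).symm⟩

theorem edgeSet_graph (T : ParentTree N) :
    T.graph.edgeSet = (fun t => s(t, T.parent t)) '' {t | t ≠ T.root} := by
  ext e
  induction e using Sym2.ind with
  | _ a b =>
    rw [SimpleGraph.mem_edgeSet]
    constructor
    · intro hab
      rw [graph, SimpleGraph.fromRel_adj] at hab
      obtain ⟨-, ⟨ha, rfl⟩ | ⟨hb, rfl⟩⟩ := hab
      · exact ⟨a, ha, rfl⟩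
      · exact ⟨b, hb, Sym2.eq_swap⟩
    · rintro ⟨t, ht, h⟩
      have := T.adj_parent ht
      rw [← SimpleGraph.mem_edgeSet] at this ⊢
      rw [← h]
      exact this

/-- A connected graph with one edge fewer than vertices is a tree. Each non-root node owns the edge
to its parent, and no edge is owned twice because ranks drop towards the root. -/
theorem graph_isTree [Finite N] (T : ParentTree N) : T.graph.IsTree := by
  rw [SimpleGraph.isTree_iff_connected_and_card]
  refine ⟨T.graph_connected, ?_⟩
  have h1 : Nat.card T.graph.edgeSet = ({t | t ≠ T.root} : Set N).ncard := by
    rw [Nat.card_coe_set_eq, edgeSet_graph, Set.InjOn.ncard_image]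
    intro s hs t ht h
    rcases Sym2.eq_iff.1 h with ⟨h, -⟩ | ⟨h1, h2⟩
    · exact h
    · have hs' := T.rank_parent_lt s hs
      have ht' := T.rank_parent_lt t ht
      rw [h2] at hs'
      rw [← h1] at ht'
      omega
  rw [h1, show ({t | t ≠ T.root} : Set N) = {T.root}ᶜ from rfl, ← Set.ncard_singleton T.root,
    add_comm, Set.ncard_add_ncard_compl]

/-- Moving to parents stays among the nodes containing `v` and lowers the rank until `τ` is met. -/
theorem rank_top_lt {T : ParentTree N} {bag : N → Finset V} {v : V} {τ : N}
    (hτ : ∀ s, v ∈ bag s → s ≠ τ → s ≠ T.root ∧ v ∈ bag (T.parent s)) (s : N) :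
    v ∈ bag s → s ≠ τ → T.rank τ < T.rank s := by
  induction s using T.induction_down with
  | _ s ih =>
    intro hs hne
    obtain ⟨h1, h2⟩ := hτ s hs hne
    have h3 := T.rank_parent_lt s h1
    by_cases h : T.parent s = τ
    · rwa [h] at h3
    · exact (ih h1 h2 h).trans h3

/-- The top node of a vertex is the one whose parent does not contain the vertex. -/
theorem IsDecomposition.exists_top {T : ParentTree N} {bag : N → Finset V}
    (hB : T.IsDecomposition bag) {v : V} {t : N} (ht : v ∈ bag t) :
    ∃ τ, v ∈ bag τ ∧ (τ = T.root ∨ v ∉ bag (T.parent τ)) ∧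
      ∀ s, v ∈ bag s → s ≠ τ → s ≠ T.root ∧ v ∈ bag (T.parent s) := by
  obtain ⟨τ, hτ, h⟩ := hB v t ht
  refine ⟨τ, hτ, ?_, h⟩
  by_contra! hcon
  have h1 := T.rank_parent_lt τ hcon.1
  have h2 := rank_top_lt h _ hcon.2 (T.parent_ne hcon.1)
  omega

/-- Pairwise covered vertices are covered by a single bag. -/
theorem IsDecomposition.exists_subset_bag {T : ParentTree N} {bag : N → Finset V}
    (hB : T.IsDecomposition bag) (K : Finset V)
    (hK : ∀ u ∈ K, ∀ v ∈ K, ∃ t, u ∈ bag t ∧ v ∈ bag t) : ∃ t, K ⊆ bag t := by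
  rcases K.eq_empty_or_nonempty with rfl | hne
  · exact ⟨T.root, by simp⟩
  have htop : ∀ v : V, ∃ τ, v ∈ K → v ∈ bag τ ∧
      ∀ s, v ∈ bag s → s ≠ τ → s ≠ T.root ∧ v ∈ bag (T.parent s) := by
    intro v
    by_cases hv : v ∈ K
    · obtain ⟨t, ht, -⟩ := hK v hv v hv
      obtain ⟨τ, h⟩ := hB v t ht
      exact ⟨τ, fun _ => h⟩
    · exact ⟨T.root, fun h => absurd h hv⟩
  choose top htop using htop
  -- Helly property of subtrees: the deepest of the top nodes works. Climbing from a bag shared by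
  -- `u` and `v` cannot leave the subtree of `u` before reaching the top of `v`.
  obtain ⟨v, hv, hmax⟩ := K.exists_max_image (fun v => T.rank (top v)) hne
  refine ⟨top v, fun u hu => ?_⟩
  have climb : ∀ s, u ∈ bag s → v ∈ bag s → u ∈ bag (top v) := by
    intro s
    induction s using T.induction_down with
    | _ s ih =>
      intro hus hvs
      by_cases hs : s = top v
      · rwa [← hs]
      have h1 := rank_top_lt (htop v hv).2 s hvs hs
      obtain ⟨h2, h3⟩ := (htop v hv).2 s hvs hs
      refine ih h2 ((htop u hu).2 s hus ?_).2 h3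
      rintro rfl
      exact absurd (hmax u hu) (not_le.2 h1)
  obtain ⟨t, h1, h2⟩ := hK u hu v hv
  exact climb t h1 h2

theorem exists_walk_to_top {T : ParentTree N} {bag : N → Finset V} {v : V} {τ : N}
    (hτ : ∀ s, v ∈ bag s → s ≠ τ → s ≠ T.root ∧ v ∈ bag (T.parent s)) (s : N) :
    v ∈ bag s → ∃ p : T.graph.Walk s τ, ∀ x ∈ p.support, v ∈ bag x := by
  induction s using T.induction_down with
  | _ s ih =>
    intro hs
    by_cases h : s = τ
    · subst h
      exact ⟨.nil, by simpa using hs⟩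
    · obtain ⟨h1, h2⟩ := hτ s hs h
      obtain ⟨p, hp⟩ := ih h1 h2
      exact ⟨.cons (T.adj_parent h1) p, by simpa [hs] using hp⟩

/-- Paths in a tree are unique, so the path from `r` to `t` lies inside the walk that climbs from
`r` to the top node of `v` and descends to `t`, and every bag on that walk contains `v`. -/
theorem IsDecomposition.mem_of_mem_support [Finite N] {T : ParentTree N} {bag : N → Finset V}
    (hB : T.IsDecomposition bag) {r s t : N} (p : T.graph.Walk r t) (hp : p.IsPath)
    (hs : s ∈ p.support) {v : V} (hr : v ∈ bag r) (ht : v ∈ bag t) : v ∈ bag s := by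
  classical
  obtain ⟨τ, -, hτ⟩ := hB v r hr
  obtain ⟨q, hq⟩ := exists_walk_to_top hτ r hr
  obtain ⟨q', hq'⟩ := exists_walk_to_top hτ t ht
  have heq : p = ((q.append q'.reverse).toPath : T.graph.Walk r t) :=
    congrArg Subtype.val
      ((T.graph_isTree.isAcyclic.subsingleton_path r t).elim ⟨p, hp⟩ (q.append q'.reverse).toPath)
  rw [heq] at hs
  have := SimpleGraph.Walk.support_toPath_subset_support _ hs
  rw [SimpleGraph.Walk.mem_support_append_iff, SimpleGraph.Walk.support_reverse,
    List.mem_reverse] at this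
  exact this.elim (hq s) (hq' s)

/-- Every rooted tree decomposition can be turned into one in which every node has at most two
children, at the cost of doubling the bags. -/
theorem IsDecomposition.exists_binary [Finite N] {T : ParentTree N} {bag : N → Finset V}
    (hB : T.IsDecomposition bag) {m : ℕ} (hm : ∀ t, (bag t).card ≤ m) :
    ∃ (T' : ParentTree N) (bag' : N → Finset V), T'.IsDecomposition bag' ∧
      (∀ t, bag t ⊆ bag' t) ∧ (∀ t, ∀ v ∈ bag' t, ∃ s, v ∈ bag s) ∧ (∀ t, (bag' t).card ≤ 2 * m) ∧
      ∀ t, (T'.children t).ncard ≤ 2 := by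
  classical
  obtain ⟨n, ⟨e⟩⟩ := Finite.exists_equiv_fin N
  -- An injective refinement of the rank, which orders the children of each node linearly.
  set key : N → ℕ := fun t => T.rank t * n + e t with hkey
  have key_inj : Function.Injective key := by
    intro s t h
    have h1 := (e s).isLt
    have h2 := (e t).isLt
    have h3 : (e s : ℕ) = e t := by
      have := congrArg (· % n) h
      simpa [hkey, Nat.mod_eq_of_lt h1, Nat.mod_eq_of_lt h2, Nat.add_mod] using this
    exact e.injective (Fin.ext h3)
  have key_parent : ∀ t, t ≠ T.root → key (T.parent t) < key t := by
    intro t ht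
    have h1 := (e (T.parent t)).isLt
    have h2 := T.rank_parent_lt t ht
    have h3 : (T.rank (T.parent t) + 1) * n ≤ T.rank t * n := Nat.mul_le_mul_right n h2
    simp only [hkey]
    rw [add_mul] at h3
    omega
  -- First-child/next-sibling encoding: the new parent of `c` is its predecessor among its siblings,
  -- or the old parent if `c` is the first child.
  have hex : ∀ c, ∃ q, (q ≠ T.root ∧ T.parent q = T.parent c ∧ key q < key c ∧
        ∀ s, s ≠ T.root → T.parent s = T.parent c → key s < key c → key s ≤ key q) ∨
      ((∀ s, s ≠ T.root → T.parent s = T.parent c → ¬ key s < key c) ∧ q = T.parent c) := by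
    intro c
    by_cases h : ∃ s, s ≠ T.root ∧ T.parent s = T.parent c ∧ key s < key c
    · obtain ⟨q, ⟨h1, h2, h3⟩, hq⟩ := Set.exists_max_image
        {s | s ≠ T.root ∧ T.parent s = T.parent c ∧ key s < key c} key (Set.toFinite _) h
      exact ⟨q, Or.inl ⟨h1, h2, h3, fun s a b d => hq s ⟨a, b, d⟩⟩⟩
    · push Not at h
      exact ⟨T.parent c, Or.inr ⟨fun s a b => not_lt.2 (h s a b), rfl⟩⟩
  choose par hpar using hex
  let T' : ParentTree N :=
    { root := T.root
      parent := par
      rank := key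
      rank_parent_lt := fun t ht => by
        rcases hpar t with h | h
        · exact h.2.2.1
        · rw [h.2]
          exact key_parent t ht }
  -- Adding the old parent's bag keeps its vertices connected along the chain of siblings.
  let bag' : N → Finset V := fun t => bag t ∪ if t = T.root then ∅ else bag (T.parent t)
  have mem_bag' : ∀ v t, v ∈ bag' t ↔ v ∈ bag t ∨ t ≠ T.root ∧ v ∈ bag (T.parent t) := by
    intro v t
    by_cases h : t = T.root <;> simp [bag', h]
  have exists_bag : ∀ t, ∀ v ∈ bag' t, ∃ s, v ∈ bag s := by
    intro t v hv
    rcases (mem_bag' v t).1 hv with h | h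
    exacts [⟨_, h⟩, ⟨_, h.2⟩]
  refine ⟨T', bag', ?_, fun t => Finset.subset_union_left, exists_bag, fun t => ?_, fun t => ?_⟩
  · intro v t hv
    obtain ⟨t₀, ht₀⟩ := exists_bag t v hv
    obtain ⟨τ, hτ, h⟩ := hB v t₀ ht₀
    refine ⟨τ, (mem_bag' v τ).2 (Or.inl hτ), fun s hs hne => ?_⟩
    have hs' : s ≠ T.root ∧ v ∈ bag (T.parent s) := by
      rcases (mem_bag' v s).1 hs with hs | hs
      exacts [h s hs hne, hs]
    refine ⟨hs'.1, (mem_bag' v _).2 ?_⟩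
    rcases hpar s with h1 | h1
    · exact Or.inr ⟨h1.1, show v ∈ bag (T.parent (par s)) by rw [h1.2.1]; exact hs'.2⟩
    · exact Or.inl (show v ∈ bag (par s) by rw [h1.2]; exact hs'.2)
  · have h1 : (if t = T.root then ∅ else bag (T.parent t)).card ≤ m := by
      split_ifs
      exacts [by simp, hm _]
    have := Finset.card_union_le (bag t) (if t = T.root then ∅ else bag (T.parent t))
    have := hm t
    change (bag t ∪ _).card ≤ _
    omega
  · let A : Set N := {c | c ≠ T.root ∧ (t ≠ T.root ∧ T.parent t = T.parent c ∧ key t < key c ∧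
        ∀ s, s ≠ T.root → T.parent s = T.parent c → key s < key c → key s ≤ key t)}
    let B : Set N := {c | c ≠ T.root ∧
      (∀ s, s ≠ T.root → T.parent s = T.parent c → ¬ key s < key c) ∧ T.parent c = t}
    have hsub : T'.children t ⊆ A ∪ B := by
      rintro c ⟨hc, rfl⟩
      rcases hpar c with h | h
      · exact Or.inl ⟨hc, h⟩
      · exact Or.inr ⟨hc, h.1, h.2.symm⟩
    have hA : A.ncard ≤ 1 := by
      refine (Set.ncard_le_one_iff (Set.toFinite _)).2 fun {c d} hc hd => key_inj ?_
      obtain ⟨hc0, -, hc1, hc2, hc3⟩ := hc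
      obtain ⟨hd0, -, hd1, hd2, hd3⟩ := hd
      rcases lt_trichotomy (key c) (key d) with h | h | h
      · have := hd3 c hc0 (hc1.symm.trans hd1) h
        omega
      · exact h
      · have := hc3 d hd0 (hd1.symm.trans hc1) h
        omega
    have hB : B.ncard ≤ 1 := by
      refine (Set.ncard_le_one_iff (Set.toFinite _)).2 fun {c d} hc hd => key_inj ?_
      have h1 := hd.2.1 c hc.1 (hc.2.2.trans hd.2.2.symm)
      have h2 := hc.2.1 d hd.1 (hd.2.2.trans hc.2.2.symm)
      omega
    have h1 := Set.ncard_le_ncard hsub (Set.toFinite _)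
    have h2 := Set.ncard_union_le A B
    omega

end ParentTree

/-! ### Rooting tree decompositions; the treewidth is attained. -/

namespace TreeDecomposition

variable {V : Type*} {G : SimpleGraph V}

/-- Every tree decomposition has a rooted form on the same nodes and bags. -/
theorem exists_parentTree (D : TreeDecomposition G) :
    ∃ T : ParentTree D.Node, T.IsDecomposition D.bag := by
  have hT := D.isTree
  choose f hf hf' using (hT.existsUnique_path · D.root)
  have not_nil : ∀ t, t ≠ D.root → ¬ (f t).Nil := fun t ht =>
    SimpleGraph.Walk.not_nil_of_ne ht
  let T : ParentTree D.Node :=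
    { root := D.root
      parent := fun t => (f t).snd
      rank := fun t => (f t).length
      rank_parent_lt := fun t ht => by
        have h1 : (f t).tail = f (f t).snd := hf' _ _ (hf t).tail
        have h2 := SimpleGraph.Walk.length_tail_add_one (not_nil t ht)
        rw [h1] at h2
        change (f (f t).snd).length < (f t).length
        omega }
  have adj_cases : ∀ s t, D.tree.Adj s t →
      s ≠ T.root ∧ T.parent s = t ∨ t ≠ T.root ∧ T.parent t = s := by
    intro s t h
    by_cases hs : t ∈ (f s).support
    · refine Or.inl ⟨?_, (hT.isAcyclic.eq_snd_of_adj_start (hf s) h hs).symm⟩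
      rintro rfl
      have : SimpleGraph.Walk.nil = f T.root := hf' T.root .nil .nil
      rw [← this] at hs
      simp only [SimpleGraph.Walk.support_nil, List.mem_singleton] at hs
      exact h.ne hs.symm
    · have h1 : SimpleGraph.Walk.cons h.symm (f s) = f t :=
        hf' t _ ((SimpleGraph.Walk.cons_isPath_iff _ _).2 ⟨hf s, hs⟩)
      refine Or.inr ⟨?_, ?_⟩
      · rintro rfl
        exact hs (f s).end_mem_support
      · change (f t).snd = s
        rw [← h1, SimpleGraph.Walk.snd_cons]
  -- A path that does not leave `s` through its parent descends at every step, since turning upwards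
  -- would revisit the preceding node.
  have key : ∀ {s t : D.Node} (p : D.tree.Walk s t), p.IsPath →
      (s ≠ T.root → T.parent s ∉ p.support) → s = t ∨ T.rank s < T.rank t := by
    intro s t p
    induction p with
    | nil => exact fun _ _ => Or.inl rfl
    | @cons s u t h p ih =>
      intro hp hs
      rw [SimpleGraph.Walk.cons_isPath_iff] at hp
      rcases adj_cases s u h with ⟨h1, h2⟩ | ⟨h1, h2⟩
      · exact absurd (by simp [h2]) (hs h1)
      · have h3 := T.rank_parent_lt u h1
        rw [h2] at h3
        rcases ih hp.1 (fun _ => h2 ▸ hp.2) with rfl | h4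
        · exact Or.inr h3
        · exact Or.inr (h3.trans h4)
  refine ⟨T, fun v t ht => ?_⟩
  have := D.fintypeNode
  obtain ⟨τ, hτ, hmin⟩ := Set.exists_min_image {t | v ∈ D.bag t} T.rank (Set.toFinite _) ⟨t, ht⟩
  refine ⟨τ, hτ, fun s hs hne => ?_⟩
  obtain ⟨p, hp, -⟩ := hT.existsUnique_path s τ
  have h1 := hmin s hs
  have h2 : s ≠ T.root ∧ T.parent s ∈ p.support := by
    by_contra! hcon
    rcases key p hp hcon with h | h
    · exact hne h
    · exact absurd h1 (not_le.2 h)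
  exact ⟨h2.1, D.connected s _ τ p hp h2.2 v hs hτ⟩

theorem neg_one_le_width (D : TreeDecomposition G) : -1 ≤ D.width := by
  unfold width
  omega

theorem width_le_iff (D : TreeDecomposition G) (m : ℕ) :
    D.width ≤ (m : ℤ) - 1 ↔ ∀ t, (D.bag t).card ≤ m := by
  let _ := D.fintypeNode
  have : D.width = ((Finset.univ.sup fun t => (D.bag t).card : ℕ) : ℤ) - 1 := rfl
  rw [this, sub_le_sub_iff_right, Nat.cast_le, Finset.sup_le_iff]
  simp

theorem treewidth_le (D : TreeDecomposition G) : treewidth G ≤ D.width :=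
  csInf_le ⟨-1, by rintro _ ⟨D, rfl⟩; exact D.neg_one_le_width⟩ ⟨D, rfl⟩

/-- The tree decomposition with a single bag. -/
def single [Fintype V] (G : SimpleGraph V) : TreeDecomposition G where
  Node := Unit
  tree := ⊥
  isTree := SimpleGraph.IsTree.of_subsingleton
  root := ()
  bag := fun _ => Finset.univ
  cover := fun v => ⟨(), Finset.mem_univ v⟩
  cover_edge := fun u v _ => ⟨(), Finset.mem_univ u, Finset.mem_univ v⟩
  connected := fun _ _ _ _ _ _ v _ _ => Finset.mem_univ v

end TreeDecomposition

theorem exists_width_eq_treewidth {V : Type*} [Finite V] (G : SimpleGraph V) :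
    ∃ D : TreeDecomposition G, D.width = treewidth G := by
  have := Fintype.ofFinite V
  exact Int.csInf_mem (s := {w : ℤ | ∃ D : TreeDecomposition G, D.width = w})
    ⟨_, TreeDecomposition.single G, rfl⟩
    ⟨-1, by rintro _ ⟨D, rfl⟩; exact D.neg_one_le_width⟩

/-! ### Decompositions of primal graphs. -/

namespace Program

variable {α : Type*}

theorem mem_atoms {P : Program α} {a : α} : a ∈ P.atoms ↔ ∃ r ∈ P, a ∈ r.atoms := by
  simp [atoms]

theorem finite_atoms {P : Program α} (hP : P.Finite) : P.atoms.Finite :=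
  hP.biUnion fun r _ => ((r.head.finite_toSet.union r.pos.finite_toSet).union r.neg.finite_toSet)

/-- A rooted decomposition covering every rule bounds the treewidth of the primal graph. -/
theorem treewidth_primalGraph_le {N : Type} [Finite N] {Q : Program α} {T : ParentTree N}
    {bag : N → Finset α} (hB : T.IsDecomposition bag)
    (hr : ∀ r ∈ Q, ∃ t, r.atoms ⊆ (bag t : Set α)) {m : ℕ} (hm : ∀ t, (bag t).card ≤ m) :
    treewidth Q.primalGraph ≤ (m : ℤ) - 1 := by
  classical
  have := Fintype.ofFinite N
  let D : TreeDecomposition Q.primalGraph :=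
    { Node := N
      tree := T.graph
      isTree := T.graph_isTree
      root := T.root
      bag := fun t => (bag t).subtype (· ∈ Q.atoms)
      cover := fun v => by
        obtain ⟨r, hrQ, hv⟩ := mem_atoms.1 v.2
        obtain ⟨t, ht⟩ := hr r hrQ
        exact ⟨t, by simpa using ht hv⟩
      cover_edge := fun u v h => by
        obtain ⟨-, r, hrQ, hu, hv⟩ := h
        obtain ⟨t, ht⟩ := hr r hrQ
        exact ⟨t, by simpa using ht hu, by simpa using ht hv⟩
      connected := fun r s t p hp hs v hvr hvt => by
        rw [Finset.mem_subtype] at hvr hvt ⊢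
        exact hB.mem_of_mem_support p hp hs hvr hvt }
  refine D.treewidth_le.trans ((D.width_le_iff m).2 fun t => ?_)
  refine le_trans ?_ (hm t)
  change ((bag t).subtype (· ∈ Q.atoms)).card ≤ _
  rw [Finset.card_subtype]
  exact Finset.card_filter_le _ _

/-- The primal graph of a finite program of treewidth at most `k` has a rooted decomposition, on
the atoms themselves, that covers every rule. -/
theorem exists_isDecomposition {P : Program α} (hP : P.Finite) {k : ℕ}
    (hk : treewidth P.primalGraph ≤ k) :
    ∃ (N : Type) (_ : Finite N) (T : ParentTree N) (bag : N → Finset α),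
      T.IsDecomposition bag ∧ (∀ r ∈ P, ∃ t, r.atoms ⊆ (bag t : Set α)) ∧
      (∀ t, (bag t).card ≤ k + 1) ∧ ∀ t, (bag t : Set α) ⊆ P.atoms := by
  classical
  have := (finite_atoms hP).to_subtype
  obtain ⟨D, hD⟩ := exists_width_eq_treewidth P.primalGraph
  obtain ⟨T, hT⟩ := D.exists_parentTree
  have := D.fintypeNode
  let bag : D.Node → Finset α := fun t => (D.bag t).map (Function.Embedding.subtype _)
  have mem_bag : ∀ a t, a ∈ bag t ↔ ∃ h : a ∈ P.atoms, (⟨a, h⟩ : P.atoms) ∈ D.bag t := by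
    intro a t
    simp [bag]
  have hB : T.IsDecomposition bag := by
    intro a t ha
    obtain ⟨h, ha⟩ := (mem_bag a t).1 ha
    obtain ⟨τ, h1, h2⟩ := hT _ t ha
    refine ⟨τ, (mem_bag _ _).2 ⟨h, h1⟩, fun s hs hne => ?_⟩
    obtain ⟨_, hs'⟩ := (mem_bag a s).1 hs
    exact ⟨(h2 s hs' hne).1, (mem_bag _ _).2 ⟨h, (h2 s hs' hne).2⟩⟩
  refine ⟨D.Node, inferInstance, T, bag, hB, fun r hr => ?_, fun t => ?_, fun t a ha => ?_⟩
  -- The atoms of a rule form a clique in the primal graph, so one bag contains them all.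
  · obtain ⟨t, ht⟩ := hB.exists_subset_bag (r.head ∪ r.pos ∪ r.neg) (by
      intro u hu v hv
      have hu' : u ∈ r.atoms := by simpa [Rule.atoms, or_assoc] using hu
      have hv' : v ∈ r.atoms := by simpa [Rule.atoms, or_assoc] using hv
      have hu'' : u ∈ P.atoms := mem_atoms.2 ⟨r, hr, hu'⟩
      have hv'' : v ∈ P.atoms := mem_atoms.2 ⟨r, hr, hv'⟩
      by_cases huv : u = v
      · subst huv
        obtain ⟨t, ht⟩ := D.cover ⟨u, hu''⟩
        exact ⟨t, (mem_bag _ _).2 ⟨_, ht⟩, (mem_bag _ _).2 ⟨_, ht⟩⟩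
      · obtain ⟨t, ht1, ht2⟩ := D.cover_edge ⟨u, hu''⟩ ⟨v, hv''⟩
          ⟨fun h => huv (congrArg Subtype.val h), r, hr, hu', hv'⟩
        exact ⟨t, (mem_bag _ _).2 ⟨_, ht1⟩, (mem_bag _ _).2 ⟨_, ht2⟩⟩)
    refine ⟨t, fun a ha => ht ?_⟩
    simpa [Rule.atoms, or_assoc] using ha
  · rw [Finset.card_map]
    refine (D.width_le_iff (k + 1)).1 ?_ t
    rw [hD]
    push_cast
    omega
  · exact ((mem_bag a t).1 ha).1

end Program

/-! ### Answer sets and canonical level mappings. -/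

namespace Program

variable {α : Type*}

theorem isModel_reduct_iff {P : Program α} {I J : Set α} :
    (P.reduct I).IsModel J ↔ ∀ r ∈ P, (r.neg : Set α) ∩ I = ∅ → (r.pos : Set α) ⊆ J →
      ((r.head : Set α) ∩ J).Nonempty := by
  constructor
  · intro h r hr hneg hpos
    have := h ⟨r.head, r.pos, ∅, r.head_pos, by simp, by simp⟩ ⟨r, hr, hneg, rfl, rfl, rfl⟩
    rcases this with h1 | ⟨x, hx, hx'⟩
    · simpa using h1
    · exact absurd (hpos hx) hx'
  · rintro h r' ⟨r, hr, hneg, hh, hp, hn⟩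
    by_cases hpos : (r.pos : Set α) ⊆ J
    · left
      rw [hh, hn]
      simpa using h r hr hneg hpos
    · right
      rw [hp]
      exact Set.sdiff_nonempty.2 hpos

theorem isModel_reduct_self_iff {P : Program α} {I : Set α} :
    (P.reduct I).IsModel I ↔ P.IsModel I := by
  rw [isModel_reduct_iff]
  refine forall₂_congr fun r _ => ?_
  rw [Rule.Satisfied, Set.union_inter_distrib_right, Set.union_nonempty, Set.sdiff_nonempty,
    ← Set.not_nonempty_iff_eq_empty]
  tauto

theorem isAnswerSet_iff {P : Program α} {I : Set α} :
    P.IsAnswerSet I ↔ P.IsModel I ∧ ∀ J ⊆ I, (P.reduct I).IsModel J → I ⊆ J := by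
  rw [IsAnswerSet, minimal_iff_forall_lt, isModel_reduct_self_iff]
  refine and_congr_right fun _ => ⟨fun h J hJ hm => ?_, fun h J hJ hm => ?_⟩
  · by_contra hcon
    exact h (lt_of_le_not_ge hJ hcon) hm
  · exact hJ.not_ge (h J hJ.le hm)

/-- Discarding foreign atoms from `I` leaves a model of the reduct, so minimality forbids them. -/
theorem IsAnswerSet.subset_atoms {P : Program α} {I : Set α} (h : P.IsAnswerSet I) :
    I ⊆ P.atoms := by
  rw [isAnswerSet_iff, ← isModel_reduct_self_iff] at h
  refine (h.2 (I ∩ P.atoms) Set.inter_subset_left ?_).trans Set.inter_subset_right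
  rw [isModel_reduct_iff] at h ⊢
  intro r hr hneg hpos
  obtain ⟨x, hx, hxI⟩ := h.1 r hr hneg (hpos.trans Set.inter_subset_left)
  exact ⟨x, hx, hxI, mem_atoms.2 ⟨r, hr, Or.inl (Or.inl hx)⟩⟩

/-- The rule `r` of `P` supports the atom `a` with respect to `I`: its body holds in `I`, and `a`
is the only head atom that can be true in `I`. -/
structure Supports (P : Program α) (I : Set α) (a : α) (r : Rule α) : Prop where
  mem : r ∈ P
  mem_head : a ∈ r.head
  pos_subset : (r.pos : Set α) ⊆ I
  neg_inter : (r.neg : Set α) ∩ I = ∅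
  eq_of_mem_head : ∀ b ∈ r.head, b ∈ I → b = a

theorem Supports.depEdge {P : Program α} {I : Set α} {a b : α} {r : Rule α}
    (h : P.Supports I a r) (hb : b ∈ r.pos) : P.DepEdge b a :=
  ⟨r, h.mem, hb, h.mem_head⟩

theorem Supports.depPath {P : Program α} {I : Set α} {a b : α} {r : Rule α}
    (h : P.Supports I a r) (hb : b ∈ r.pos) : P.DepPath b a :=
  Relation.TransGen.single (h.depEdge hb)

/-- The canonical level mapping of an interpretation, relative to the strongly connected
components of the positive dependency digraph. -/
structure IsLevelling (P : Program α) (I : Set α) (lev : α → ℕ) : Prop where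
  eq_zero : ∀ a ∉ I, lev a = 0
  upper : ∀ a ∈ I, ∀ r, P.Supports I a r →
    lev a = 0 ∨ ∃ b ∈ r.pos, P.DepPath a b ∧ lev a ≤ lev b + 1
  proven : ∀ a ∈ I, ∃ r, P.Supports I a r ∧ ∀ b ∈ r.pos, P.DepPath a b → lev b < lev a

/-- Strong induction on `lev' a`: the rule that proves `a` for `lev'` also supports it, so `upper`
for `lev` bounds `lev a` by one more than the level of a body atom, which is smaller under `lev'`.
-/
theorem IsLevelling.le {P : Program α} {I : Set α} {lev lev' : α → ℕ}
    (h : P.IsLevelling I lev) (h' : P.IsLevelling I lev') (a : α) (ha : a ∈ I) :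
    lev a ≤ lev' a := by
  induction hn : lev' a using Nat.strong_induction_on generalizing a with
  | _ n ih =>
    obtain ⟨r, hr, hlt⟩ := h'.proven a ha
    rcases h.upper a ha r hr with h0 | ⟨b, hb, hab, hle⟩
    · omega
    · have h1 := hlt b hb hab
      have h2 := ih (lev' b) (hn ▸ h1) b (hr.pos_subset hb) rfl
      omega

theorem IsLevelling.unique {P : Program α} {I : Set α} {lev lev' : α → ℕ}
    (h : P.IsLevelling I lev) (h' : P.IsLevelling I lev') : lev = lev' := by
  funext a
  by_cases ha : a ∈ I
  · exact le_antisymm (h.le h' a ha) (h'.le h a ha)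
  · rw [h.eq_zero a ha, h'.eq_zero a ha]

theorem mem_depVertices_of_mem_head {P : Program α} {r : Rule α} (hr : r ∈ P) {a : α}
    (ha : a ∈ r.head) : a ∈ P.depVertices :=
  Set.mem_biUnion hr (Or.inl ha)

theorem DepEdge.mem_depVertices {P : Program α} {a b : α} (h : P.DepEdge a b) :
    a ∈ P.depVertices ∧ b ∈ P.depVertices := by
  obtain ⟨r, hr, ha, hb⟩ := h
  exact ⟨Set.mem_biUnion hr (Or.inr ha), Set.mem_biUnion hr (Or.inl hb)⟩

theorem DepPath.mem_depVertices {P : Program α} {a b : α} (h : P.DepPath a b) :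
    a ∈ P.depVertices ∧ b ∈ P.depVertices := by
  induction h with
  | single h => exact h.mem_depVertices
  | tail _ h ih => exact ⟨ih.1, h.mem_depVertices.2⟩

theorem depVertices_subset_atoms (P : Program α) : P.depVertices ⊆ P.atoms :=
  Set.biUnion_mono subset_rfl fun _ _ => Set.subset_union_left

/-- The strongly connected component of an atom. -/
def component (P : Program α) (a : α) : Set α := {b | b = a ∨ P.DepPath a b ∧ P.DepPath b a}

theorem isSCC_component {P : Program α} {a : α} (ha : a ∈ P.depVertices) :
    P.IsSCC (P.component a) := by
  refine ⟨⟨a, Or.inl rfl⟩, ⟨?_, ?_⟩, ?_⟩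
  · rintro b (rfl | hb)
    exacts [ha, hb.1.mem_depVertices.2]
  · rintro u (rfl | hu) v (rfl | hv) huv
    exacts [absurd rfl huv, hv.1, hu.2, hu.2.trans hv.1]
  · intro C hC hle b hb
    by_cases hab : b = a
    · exact Or.inl hab
    · have haC : a ∈ C := hle (Or.inl rfl)
      exact Or.inr ⟨hC.2 a haC b hb (Ne.symm hab), hC.2 b hb a haC hab⟩

theorem finite_component {P : Program α} (hP : P.Finite) (a : α) : (P.component a).Finite :=
  ((finite_atoms hP).insert a).subset fun _ hb => hb.imp id fun h =>
    P.depVertices_subset_atoms h.1.mem_depVertices.2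

/-- All levels below the level of an atom are attained within its component. -/
theorem IsLevelling.exists_of_le {P : Program α} {I : Set α} {lev : α → ℕ}
    (h : P.IsLevelling I lev) (n : ℕ) :
    ∀ a ∈ I, lev a = n → ∀ m ≤ n, ∃ b ∈ P.component a, lev b = m := by
  induction n with
  | zero => exact fun a _ hn m hm => ⟨a, Or.inl rfl, by omega⟩
  | succ n ih =>
    intro a ha hn m hm
    rcases Nat.lt_or_ge n m with hnm | hnm
    · exact ⟨a, Or.inl rfl, by omega⟩
    obtain ⟨r, hr, hlt⟩ := h.proven a ha
    rcases h.upper a ha r hr with h0 | ⟨b, hb, hab, hle⟩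
    · omega
    have hlt := hlt b hb hab
    have hba := hr.depPath hb
    obtain ⟨c, hc, hcm⟩ := ih b (hr.pos_subset hb) (by omega) m hnm
    refine ⟨c, ?_, hcm⟩
    rcases hc with rfl | hc
    · exact Or.inr ⟨hab, hba⟩
    · exact Or.inr ⟨hab.trans hc.1, hc.2.trans hba⟩

/-- The values 0, …, `lev a` are all taken on the component of `a`, which therefore has at least
`lev a + 1` elements. -/
theorem IsLevelling.lt_of_isSCC_bound {P : Program α} (hP : P.Finite) {I : Set α} {lev : α → ℕ}
    (h : P.IsLevelling I lev) {ℓ : ℕ} (hℓ : ∀ C, P.IsSCC C → C.ncard + 1 ≤ ℓ)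
    {a : α} (ha : a ∈ I) : lev a < ℓ := by
  obtain ⟨r, hr, -⟩ := h.proven a ha
  have h1 := hℓ _ (isSCC_component (mem_depVertices_of_mem_head hr.mem hr.mem_head))
  have hfin := finite_component hP a
  have h2 : (Finset.range (lev a + 1) : Set ℕ) ⊆ lev '' P.component a := by
    intro m hm
    exact h.exists_of_le _ a ha rfl m (by simpa [Nat.lt_succ_iff] using hm)
  have h3 := Set.ncard_le_ncard h2 (hfin.image _)
  rw [Set.ncard_coe_finset, Finset.card_range] at h3
  have h4 := Set.ncard_image_le (f := lev) hfin
  omega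

/-- Were `J` a smaller model of the reduct, take an atom of `I \ J` minimal for the lexicographic
order by number of dependency predecessors, then level. Each body atom of its proving rule is
smaller (in level within the component, in predecessor count otherwise), so the body holds in `J`;
the rule then forces the atom itself into `J`, as no other head atom is in `I`. -/
theorem IsLevelling.isAnswerSet {P : Program α} (hP : P.Finite) {I : Set α} {lev : α → ℕ}
    (h : P.IsLevelling I lev) (hI : P.IsModel I) : P.IsAnswerSet I := by
  rw [isAnswerSet_iff]
  refine ⟨hI, fun J hJ hm => ?_⟩
  rw [isModel_reduct_iff] at hm
  by_contra hcon
  let below : α → Set α := fun a => {b | b = a ∨ P.DepPath b a}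
  have hfin : ∀ a, (below a).Finite := fun a =>
    ((finite_atoms hP).insert a).subset fun b hb => hb.imp id fun h =>
      P.depVertices_subset_atoms h.mem_depVertices.1
  have hIfin : I.Finite := (finite_atoms hP).subset fun a ha => by
    obtain ⟨r, hr, -⟩ := h.proven a ha
    exact mem_atoms.2 ⟨r, hr.mem, Or.inl (Or.inl hr.mem_head)⟩
  obtain ⟨a, ⟨haI, haJ⟩, hmin⟩ := Set.exists_min_image (I \ J)
    (fun a => toLex ((below a).ncard, lev a)) (hIfin.subset Set.sdiff_subset)
    (Set.sdiff_nonempty.2 hcon)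
  obtain ⟨r, hr, hlt⟩ := h.proven a haI
  have hpos : (r.pos : Set α) ⊆ J := by
    intro b hb
    by_contra hbJ
    have h1 := hmin b ⟨hr.pos_subset hb, hbJ⟩
    rw [Prod.Lex.toLex_le_toLex] at h1
    dsimp only at h1
    have hba := hr.depPath hb
    have hsub : below b ⊆ below a := by
      rintro c (rfl | hc)
      exacts [Or.inr hba, Or.inr (hc.trans hba)]
    have hle := Set.ncard_le_ncard hsub (hfin a)
    by_cases hab : P.DepPath a b
    · have := hlt b hb hab
      omega
    · have hne : a ∉ below b := by
        rintro (rfl | h)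
        · exact Finset.disjoint_left.1 r.head_pos hr.mem_head hb
        · exact hab h
      have := Set.ncard_lt_ncard
        (Set.ssubset_iff_of_subset hsub |>.2 ⟨a, Or.inl rfl, hne⟩) (hfin a)
      omega
  obtain ⟨x, hx, hxJ⟩ := hm r hr.mem hr.neg_inter hpos
  rw [hr.eq_of_mem_head x hx (hJ hxJ)] at hxJ
  exact haJ hxJ

/-- The atoms derived in `n` rounds, where body atoms outside of the component of the head atom
are taken for granted. -/
def stage (P : Program α) (I : Set α) : ℕ → Set α
  | 0 => ∅
  | n + 1 => {a | a ∈ I ∧ ∃ r, P.Supports I a r ∧ ∀ b ∈ r.pos, P.DepPath a b → b ∈ P.stage I n}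

theorem stage_mono (P : Program α) (I : Set α) : Monotone (P.stage I) := by
  refine monotone_nat_of_le_succ fun n => ?_
  induction n with
  | zero => exact Set.empty_subset _
  | succ n ih =>
    rintro a ⟨ha, r, hr, h⟩
    exact ⟨ha, r, hr, fun b hb hab => ih (h b hb hab)⟩

theorem exists_subset_stage {P : Program α} {I : Set α} (K : Finset α)
    (hK : ∀ b ∈ K, ∃ n, b ∈ P.stage I n) : ∃ n, ∀ b ∈ K, b ∈ P.stage I n := by
  classical
  have : ∀ b, ∃ n, b ∈ K → b ∈ P.stage I n := fun b => by
    by_cases hb : b ∈ K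
    · obtain ⟨n, hn⟩ := hK b hb
      exact ⟨n, fun _ => hn⟩
    · exact ⟨0, fun h => absurd h hb⟩
  choose f hf using this
  exact ⟨K.sup f, fun b hb => P.stage_mono I (Finset.le_sup hb) (hf b hb)⟩

/-- In an answer set of a head-cycle-free program every atom is derived at some stage. -/
theorem IsAnswerSet.exists_mem_stage {P : Program α} (hP : P.IsHCF) {I : Set α}
    (h : P.IsAnswerSet I) {a : α} (ha : a ∈ I) : ∃ n, a ∈ P.stage I n := by
  classical
  by_contra hcon
  rw [isAnswerSet_iff, ← isModel_reduct_self_iff, isModel_reduct_iff] at h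
  -- Deleting the underived atoms of a single component leaves a model of the reduct, contradicting
  -- minimality. Restricting to one component is what makes head-cycle-freeness applicable.
  let U : Set α := {b | b ∈ P.component a ∧ ¬ ∃ n, b ∈ P.stage I n}
  refine (h.2 (I \ U) Set.sdiff_subset ?_ ha).2 ⟨Or.inl rfl, hcon⟩
  rw [isModel_reduct_iff]
  intro r hr hneg hpos
  obtain ⟨x, hx, hxI⟩ := h.1 r hr hneg (hpos.trans Set.sdiff_subset)
  by_contra hempty
  have hU : ∀ y ∈ r.head, y ∈ I → y ∈ U := fun y hy hyI => by
    by_contra hyU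
    exact hempty ⟨y, hy, hyI, hyU⟩
  have hcomp : ∀ u ∈ P.component a, ∀ v ∈ P.component a, u ≠ v → P.DepPath u v := by
    rintro u (rfl | hu) v (rfl | hv) huv
    exacts [absurd rfl huv, hv.1, hu.2, hu.2.trans hv.1]
  have hxU := hU x hx hxI
  -- All true head atoms lie in `U`, hence in one component; two different ones would lie on a
  -- common cycle.
  have hsupp : P.Supports I x r := by
    refine ⟨hr, hx, hpos.trans Set.sdiff_subset, hneg, fun y hy hyI => ?_⟩
    by_contra hyx
    have hyU := hU y hy hyI
    exact hP r hr y hy x hx hyx ⟨hcomp y hyU.1 x hxU.1 hyx, hcomp x hxU.1 y hyU.1 (Ne.symm hyx)⟩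
  -- Body atoms in the component of `x` avoid `U`, hence are derived, and finitely many of them are
  -- derived by a common stage.
  obtain ⟨n, hn⟩ := exists_subset_stage (P := P) (I := I) (r.pos.filter (P.DepPath x)) (by
    intro b hb
    rw [Finset.mem_filter] at hb
    by_contra hbn
    refine (hpos hb.1).2 ⟨?_, hbn⟩
    have hbx := hsupp.depPath hb.1
    rcases hxU.1 with rfl | hxa
    · exact Or.inr ⟨hb.2, hbx⟩
    · exact Or.inr ⟨hxa.1.trans hb.2, hbx.trans hxa.2⟩)
  exact hxU.2 ⟨n + 1, hxI, r, hsupp, fun b hb hxb => hn b (Finset.mem_filter.2 ⟨hb, hxb⟩)⟩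

/-- The level of an atom is the least `n` with the atom in stage `n + 1`. The shift makes level zero
mean provable without recursive body atoms, and the convention `sInf ∅ = 0` gives false atoms level
zero. -/
theorem IsAnswerSet.exists_isLevelling {P : Program α} (hP : P.IsHCF) {I : Set α}
    (h : P.IsAnswerSet I) : ∃ lev, P.IsLevelling I lev := by
  have hle : ∀ a n, a ∈ P.stage I (n + 1) → sInf {n | a ∈ P.stage I (n + 1)} ≤ n :=
    fun a n hn => Nat.sInf_le hn
  have hmem : ∀ a ∈ I, a ∈ P.stage I (sInf {n | a ∈ P.stage I (n + 1)} + 1) := by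
    intro a ha
    refine Nat.sInf_mem (s := {n | a ∈ P.stage I (n + 1)}) ?_
    obtain ⟨n, hn⟩ := h.exists_mem_stage hP ha
    cases n with
    | zero => exact absurd hn (Set.notMem_empty a)
    | succ n => exact ⟨n, hn⟩
  refine ⟨fun a => sInf {n | a ∈ P.stage I (n + 1)}, fun a ha => ?_, fun a ha r hr => ?_,
    fun a ha => ?_⟩
  · have : {n | a ∈ P.stage I (n + 1)} = ∅ :=
      Set.eq_empty_of_forall_notMem fun n hn => ha hn.1
    simp [this]
  · by_contra! hcon
    obtain ⟨h0, hlt⟩ := hcon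
    obtain ⟨n, hn⟩ := Nat.exists_eq_succ_of_ne_zero h0
    rw [Nat.succ_eq_add_one] at hn
    have : a ∈ P.stage I (n + 1) := by
      refine ⟨ha, r, hr, fun b hb hab => ?_⟩
      have h1 := hlt b hb hab
      rw [hn] at h1
      exact P.stage_mono I (by omega) (hmem b (hr.pos_subset hb))
    have := hle a n this
    omega
  · obtain ⟨-, r, hr, hlt⟩ := hmem a ha
    refine ⟨r, hr, fun b hb hab => ?_⟩
    have hb := hlt b hb hab
    generalize sInf {n | a ∈ P.stage I (n + 1)} = m at hb
    cases m with
    | zero => exact absurd hb (Set.notMem_empty b)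
    | succ m => exact Nat.lt_succ_of_le (hle b m hb)

end Program

/-! ### Boolean constraint problems as tight programs. -/

namespace Program

variable {α : Type*} {S : Type*} {N : Type}

theorem finite_of_atoms_subset {Q : Program α} (F : Finset α) (h : ∀ r ∈ Q, r.atoms ⊆ (F : Set α)) :
    Q.Finite := by
  classical
  have hinj : Function.Injective fun r : Rule α => (r.head, r.pos, r.neg) := by
    intro r s h
    simp only [Prod.mk.injEq] at h
    exact Rule.ext h.1 h.2.1 h.2.2
  refine ((F.powerset ×ˢ F.powerset ×ˢ F.powerset).finite_toSet.preimage hinj.injOn).subset ?_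
  intro r hr
  have h1 := h r hr
  simp only [Set.mem_preimage, Finset.coe_product, Set.mem_prod, Finset.mem_coe,
    Finset.mem_powerset]
  exact ⟨fun a ha => h1 (Or.inl (Or.inl ha)), fun a ha => h1 (Or.inl (Or.inr ha)),
    fun a ha => h1 (Or.inr ha)⟩

/-- The program of a Boolean constraint satisfaction problem: the variable `s` is represented by the
complementary atoms `e s true` and `e s false`, one of which is chosen by a disjunctive fact, and
each forbidden assignment `K` of a scope `scope t` is excluded by a rule with empty head. -/
def ofConstraints (e : S → Bool → α) (scope : N → Finset S) (Good : N → Set S → Prop) :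
    Program α :=
  {r | ∃ t, ∃ s ∈ scope t, (r.head : Set α) = {e s true, e s false} ∧ r.pos = ∅ ∧ r.neg = ∅} ∪
  {r | ∃ t, ∃ K ⊆ (scope t : Set S), ¬ Good t K ∧ r.head = ∅ ∧
    (r.pos : Set α) = (e · true) '' K ∧ (r.neg : Set α) = (e · true) '' (scope t \ K)}

/-- The interpretation representing the assignment `X`. -/
def encode (e : S → Bool → α) (scope : N → Finset S) (X : Set S) : Set α :=
  {x | ∃ t, ∃ s ∈ scope t, s ∈ X ∧ x = e s true ∨ s ∉ X ∧ x = e s false}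

section ofConstraints

variable {e : S → Bool → α} {scope : N → Finset S} {Good : N → Set S → Prop}

/-- No rule has both a head and a positive body, so there are no dependency edges. -/
theorem isTight_ofConstraints : (ofConstraints e scope Good).IsTight := by
  have hno : ∀ a b, ¬ (ofConstraints e scope Good).DepEdge a b := by
    rintro a b ⟨r, ⟨t, s, hs, -, hpos, -⟩ | ⟨t, K, -, -, hhead, -⟩, ha, hb⟩
    · simp [hpos] at ha
    · simp [hhead] at hb
  intro a h
  obtain ⟨b, hb, -⟩ := Relation.TransGen.head'_iff.1 h
  exact hno a b hb

theorem exists_atoms_subset_of_mem_ofConstraints {r : Rule α}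
    (hr : r ∈ ofConstraints e scope Good) :
    ∃ t, ∀ a ∈ r.atoms, ∃ s ∈ scope t, ∃ b, a = e s b := by
  rcases hr with ⟨t, s, hs, hhead, hpos, hneg⟩ | ⟨t, K, hK, -, hhead, hpos, hneg⟩
  · refine ⟨t, fun a ha => ?_⟩
    rw [Rule.atoms, hhead, hpos, hneg] at ha
    simp only [Finset.coe_empty, Set.union_empty, Set.mem_insert_iff, Set.mem_singleton_iff] at ha
    rcases ha with rfl | rfl
    exacts [⟨s, hs, _, rfl⟩, ⟨s, hs, _, rfl⟩]
  · refine ⟨t, fun a ha => ?_⟩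
    rw [Rule.atoms, hhead, hpos, hneg] at ha
    rcases ha with (ha | ⟨s, hs, rfl⟩) | ⟨s, hs, rfl⟩
    · simp at ha
    · exact ⟨s, hK hs, _, rfl⟩
    · exact ⟨s, hs.1, _, rfl⟩

/-- The atoms representing literals over variables in scope are pairwise distinct. -/
def IsEncoding (e : S → Bool → α) (scope : N → Finset S) : Prop :=
  ∀ t, ∀ s ∈ scope t, ∀ t', ∀ s' ∈ scope t', ∀ b b', e s b = e s' b' → s = s' ∧ b = b'

theorem true_mem_encode (hinj : IsEncoding e scope) {t : N} {s : S} (hs : s ∈ scope t)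
    (X : Set S) : e s true ∈ encode e scope X ↔ s ∈ X := by
  constructor
  · rintro ⟨t', s', hs', ⟨h, heq⟩ | ⟨h, heq⟩⟩
    · rwa [(hinj _ _ hs _ _ hs' _ _ heq).1]
    · exact absurd (hinj _ _ hs _ _ hs' _ _ heq).2 (by simp)
  · exact fun h => ⟨t, s, hs, Or.inl ⟨h, rfl⟩⟩

theorem false_mem_encode (hinj : IsEncoding e scope) {t : N} {s : S} (hs : s ∈ scope t)
    (X : Set S) : e s false ∈ encode e scope X ↔ s ∉ X := by
  constructor
  · rintro ⟨t', s', hs', ⟨h, heq⟩ | ⟨h, heq⟩⟩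
    · exact absurd (hinj _ _ hs _ _ hs' _ _ heq).2 (by simp)
    · rwa [(hinj _ _ hs _ _ hs' _ _ heq).1]
  · exact fun h => ⟨t, s, hs, Or.inr ⟨h, rfl⟩⟩

theorem mem_or_mem_of_isModel_reduct {I J : Set α}
    (h : ((ofConstraints e scope Good).reduct I).IsModel J) {t : N} {s : S} (hs : s ∈ scope t) :
    e s true ∈ J ∨ e s false ∈ J := by
  classical
  rw [isModel_reduct_iff] at h
  obtain ⟨x, hx, hxJ⟩ := h
    ⟨{e s true, e s false}, ∅, ∅, Finset.disjoint_empty_right _, Finset.disjoint_empty_right _,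
      Finset.disjoint_empty_right _⟩
    (Or.inl ⟨t, s, hs, by simp, rfl, rfl⟩) (by simp) (by simp)
  rw [Finset.mem_coe, Finset.mem_insert, Finset.mem_singleton] at hx
  rcases hx with rfl | rfl
  exacts [Or.inl hxJ, Or.inr hxJ]

/-- The encoding contains exactly one literal of each scoped variable, so the disjunctive facts
alone make it minimal. A constraint for `K` whose body holds forces `K` to agree with `X` on the
scope, so `K` would be good by locality. -/
theorem isAnswerSet_encode (hinj : IsEncoding e scope)
    (hloc : ∀ t X Y, (∀ s ∈ scope t, s ∈ X ↔ s ∈ Y) → Good t X → Good t Y)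
    {X : Set S} (hX : ∀ t, Good t X) :
    (ofConstraints e scope Good).IsAnswerSet (encode e scope X) := by
  rw [isAnswerSet_iff, ← isModel_reduct_self_iff]
  constructor
  · rw [isModel_reduct_iff]
    rintro r (⟨t, s, hs, hhead, -, -⟩ | ⟨t, K, hK, hbad, -, hp, hn⟩) hneg hpos
    · rw [hhead]
      by_cases h : s ∈ X
      · exact ⟨e s true, Or.inl rfl, (true_mem_encode hinj hs X).2 h⟩
      · exact ⟨e s false, Or.inr rfl, (false_mem_encode hinj hs X).2 h⟩
    · refine absurd (hloc t X K (fun s hs => ⟨fun hsX => ?_, fun hsK => ?_⟩) (hX t)) hbad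
      · by_contra hsK
        rw [hn] at hneg
        exact Set.notMem_empty (e s true)
          (hneg ▸ ⟨⟨s, ⟨hs, hsK⟩, rfl⟩, (true_mem_encode hinj hs X).2 hsX⟩)
      · rw [hp] at hpos
        exact (true_mem_encode hinj hs X).1 (hpos ⟨s, hsK, rfl⟩)
  · rintro J hJ hm x ⟨t, s, hs, ⟨h, rfl⟩ | ⟨h, rfl⟩⟩
    · refine (mem_or_mem_of_isModel_reduct hm hs).resolve_right fun hf => ?_
      exact (false_mem_encode hinj hs X).1 (hJ hf) h
    · refine (mem_or_mem_of_isModel_reduct hm hs).resolve_left fun ht => ?_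
      exact h ((true_mem_encode hinj hs X).1 (hJ ht))

/-- Reading `X` off the true literals, its encoding lies inside `I` and still models the reduct: the
headless rules persist when the interpretation shrinks. Minimality gives equality, so no answer set
contains both literals of a variable. -/
theorem exists_eq_encode (hinj : IsEncoding e scope)
    (hloc : ∀ t X Y, (∀ s ∈ scope t, s ∈ X ↔ s ∈ Y) → Good t X → Good t Y)
    {I : Set α} (hI : (ofConstraints e scope Good).IsAnswerSet I) :
    ∃ X : Set S, (∀ s ∈ X, ∃ t, s ∈ scope t) ∧ (∀ t, Good t X) ∧ I = encode e scope X := by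
  classical
  rw [isAnswerSet_iff, ← isModel_reduct_self_iff] at hI
  obtain ⟨hm, hmin⟩ := hI
  let X : Set S := {s | (∃ t, s ∈ scope t) ∧ e s true ∈ I}
  have hsub : encode e scope X ⊆ I := by
    rintro x ⟨t, s, hs, ⟨h, rfl⟩ | ⟨h, rfl⟩⟩
    · exact h.2
    · exact (mem_or_mem_of_isModel_reduct hm hs).resolve_left fun ht => h ⟨⟨t, hs⟩, ht⟩
  have hm' := isModel_reduct_iff.1 hm
  refine ⟨X, fun s hs => hs.1, fun t => ?_, (hmin _ hsub ?_).antisymm hsub⟩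
  · by_contra hbad
    -- If the local part of `X` were forbidden, its own headless rule would be violated by `I`.
    let K : Finset S := (scope t).filter (· ∈ X)
    have hdisj : Disjoint (K.image (e · true)) ((scope t \ K).image (e · true)) := by
      rw [Finset.disjoint_left]
      intro x hx hx'
      obtain ⟨s, hs, rfl⟩ := Finset.mem_image.1 hx
      obtain ⟨s', hs', heq⟩ := Finset.mem_image.1 hx'
      rw [Finset.mem_sdiff] at hs'
      have h1 := (hinj t s' hs'.1 t s (Finset.mem_filter.1 hs).1 _ _ heq).1
      exact hs'.2 (h1 ▸ hs)
    refine Set.not_nonempty_empty ((hm'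
      ⟨∅, K.image (e · true), (scope t \ K).image (e · true), Finset.disjoint_empty_left _,
        Finset.disjoint_empty_left _, hdisj⟩
      (Or.inr ⟨t, K, Finset.coe_subset.2 (Finset.filter_subset _ _), fun h => hbad
        (hloc t K X (fun s hs => by simp [K, hs]) h), rfl, by simp, by simp⟩) ?_ ?_).mono
        (by simp))
    · rw [Set.eq_empty_iff_forall_notMem]
      rintro x ⟨hx, hxI⟩
      obtain ⟨s, hs, rfl⟩ := Finset.mem_image.1 (Finset.mem_coe.1 hx)
      rw [Finset.mem_sdiff, Finset.mem_filter] at hs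
      exact hs.2 ⟨hs.1, ⟨t, hs.1⟩, hxI⟩
    · intro x hx
      obtain ⟨s, hs, rfl⟩ := Finset.mem_image.1 (Finset.mem_coe.1 hx)
      exact (Finset.mem_filter.1 hs).2.2
  · rw [isModel_reduct_iff]
    rintro r (⟨t, s, hs, hhead, -, -⟩ | ⟨t, K, hK, hbad, hhead, hp, hn⟩) hneg hpos
    · rw [hhead]
      by_cases h : s ∈ X
      · exact ⟨e s true, Or.inl rfl, (true_mem_encode hinj hs X).2 h⟩
      · exact ⟨e s false, Or.inr rfl, (false_mem_encode hinj hs X).2 h⟩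
    · obtain ⟨x, hx, -⟩ := hm' r (Or.inr ⟨t, K, hK, hbad, hhead, hp, hn⟩) hneg (hpos.trans hsub)
      simp [hhead] at hx

end ofConstraints

/-- Fresh atoms for the literals over finitely many variables, where the positive literals of some
distinguished variables are given atoms. -/
theorem exists_literals [Infinite α] {A : Set α} (hA : A.Finite) (o : α → S)
    (ho : Function.Injective o) {W : Set S} (hW : W.Finite) :
    ∃ e : S → Bool → α, (∀ s ∈ W, ∀ s' ∈ W, ∀ b b', e s b = e s' b' → s = s' ∧ b = b') ∧
      (∀ a ∈ A, e (o a) true = a) ∧ ∀ s ∈ W, ∀ b, e s b ∈ A → b = true ∧ s = o (e s b) := by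
  classical
  have : Nonempty α := inferInstance
  -- The complement of `A` is infinite, so it has room for a fresh atom for every literal.
  obtain ⟨g, hg, hginj⟩ := (hW.prod (Set.finite_univ (α := Bool))).exists_injOn_of_encard_le
    (t := Aᶜ) (by rw [hA.infinite_compl.encard_eq]; exact le_top)
  have hg' : ∀ s ∈ W, ∀ b, g (s, b) ∉ A := fun s hs b => hg (Set.mk_mem_prod hs (Set.mem_univ b))
  let e : S → Bool → α := fun s b =>
    if h : b = true ∧ ∃ a ∈ A, o a = s then h.2.choose else g (s, b)
  have he : ∀ s b, (b = true ∧ e s b ∈ A ∧ s = o (e s b)) ∨ e s b = g (s, b) := by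
    intro s b
    by_cases h : b = true ∧ ∃ a ∈ A, o a = s
    · have h1 : e s b = h.2.choose := dif_pos h
      rw [h1]
      exact Or.inl ⟨h.1, h.2.choose_spec.1, h.2.choose_spec.2.symm⟩
    · exact Or.inr (dif_neg h)
  refine ⟨e, fun s hs s' hs' b b' heq => ?_, fun a ha => ?_, fun s hs b hb => ?_⟩
  · rcases he s b with ⟨h1, h2, h3⟩ | h1 <;> rcases he s' b' with ⟨h1', h2', h3'⟩ | h1'
    · exact ⟨by rw [h3, h3', heq], by rw [h1, h1']⟩
    · rw [heq, h1'] at h2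
      exact absurd h2 (hg' s' hs' b')
    · rw [← heq, h1] at h2'
      exact absurd h2' (hg' s hs b)
    · rw [h1, h1'] at heq
      exact Prod.mk.injEq _ _ _ _ ▸ hginj (Set.mk_mem_prod hs (Set.mem_univ b))
        (Set.mk_mem_prod hs' (Set.mem_univ b')) heq
  · have h : true = true ∧ ∃ a' ∈ A, o a' = o a := ⟨rfl, a, ha, rfl⟩
    have h1 : e (o a) true = h.2.choose := dif_pos h
    rw [h1]
    exact ho h.2.choose_spec.2
  · rcases he s b with ⟨h1, -, h3⟩ | h1
    · exact ⟨h1, h3⟩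
    · rw [h1] at hb
      exact absurd hb (hg' s hs b)

/-- A Boolean constraint satisfaction problem over a rooted tree decomposition is expressed by a
tight program of small treewidth, whose answer sets correspond to the solutions. -/
theorem exists_isTight_of_constraints [Infinite α] [Finite N] {T : ParentTree N}
    {scope : N → Finset S} (hB : T.IsDecomposition scope) {m : ℕ} (hm : ∀ t, (scope t).card ≤ m)
    {Good : N → Set S → Prop}
    (hloc : ∀ t X Y, (∀ s ∈ scope t, s ∈ X ↔ s ∈ Y) → Good t X → Good t Y)
    {A : Set α} (hA : A.Finite) (o : α → S) (ho : Function.Injective o) {𝒮 : Set (Set α)}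
    (h𝒮 : Set.BijOn (fun X => {a | a ∈ A ∧ o a ∈ X})
      {X : Set S | (∀ s ∈ X, ∃ t, s ∈ scope t) ∧ ∀ t, Good t X} 𝒮) :
    ∃ Q : Program α, Q.Finite ∧ Q.IsTight ∧ treewidth Q.primalGraph ≤ ((2 * m : ℕ) : ℤ) - 1 ∧
      Set.BijOn (fun I => I ∩ A) {I | Q.IsAnswerSet I} 𝒮 := by
  classical
  have := Fintype.ofFinite N
  have hW : {s | ∃ t, s ∈ scope t}.Finite :=
    (Finset.univ.biUnion scope).finite_toSet.subset fun s hs => by simpa using hs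
  obtain ⟨e, he, heA, heA'⟩ := exists_literals hA o ho hW
  have hinj : IsEncoding e scope := fun t s hs t' s' hs' => he s ⟨t, hs⟩ s' ⟨t', hs'⟩
  -- Two atoms per variable, whence the factor 2 in the width.
  let bag : N → Finset α := fun t => (scope t).image (e · true) ∪ (scope t).image (e · false)
  have mem_bag : ∀ x t, x ∈ bag t ↔ ∃ s ∈ scope t, ∃ b, x = e s b := by
    intro x t
    simp only [bag, Finset.mem_union, Finset.mem_image, Bool.exists_bool]
    constructor
    · rintro (⟨s, hs, rfl⟩ | ⟨s, hs, rfl⟩)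
      exacts [⟨s, hs, Or.inr rfl⟩, ⟨s, hs, Or.inl rfl⟩]
    · rintro ⟨s, hs, rfl | rfl⟩
      exacts [Or.inr ⟨s, hs, rfl⟩, Or.inl ⟨s, hs, rfl⟩]
  have hbag : T.IsDecomposition bag := by
    intro x t hx
    obtain ⟨s, hs, b, rfl⟩ := (mem_bag x t).1 hx
    obtain ⟨τ, hτ, h⟩ := hB s t hs
    refine ⟨τ, (mem_bag _ _).2 ⟨s, hτ, b, rfl⟩, fun t' ht' hne => ?_⟩
    obtain ⟨s', hs', b', heq⟩ := (mem_bag _ _).1 ht'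
    obtain ⟨rfl, -⟩ := hinj t s hs t' s' hs' _ _ heq
    exact ⟨(h t' hs' hne).1, (mem_bag _ _).2 ⟨s, (h t' hs' hne).2, b, rfl⟩⟩
  have hcover : ∀ r ∈ ofConstraints e scope Good, ∃ t, r.atoms ⊆ (bag t : Set α) := by
    intro r hr
    obtain ⟨t, ht⟩ := exists_atoms_subset_of_mem_ofConstraints hr
    exact ⟨t, fun a ha => (mem_bag a t).2 (ht a ha)⟩
  have hF : ∀ X : Set S, (∀ s ∈ X, ∃ t, s ∈ scope t) →
      encode e scope X ∩ A = {a | a ∈ A ∧ o a ∈ X} := by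
    intro X hX
    ext a
    constructor
    · rintro ⟨⟨t, s, hs, ⟨h, rfl⟩ | ⟨h, rfl⟩⟩, ha⟩
      · exact ⟨ha, by rwa [← (heA' s ⟨t, hs⟩ _ ha).2]⟩
      · exact absurd (heA' s ⟨t, hs⟩ _ ha).1 (by simp)
    · rintro ⟨ha, h⟩
      obtain ⟨t, ht⟩ := hX _ h
      exact ⟨⟨t, o a, ht, Or.inl ⟨h, (heA a ha).symm⟩⟩, ha⟩
  refine ⟨ofConstraints e scope Good, ?_, isTight_ofConstraints,
    treewidth_primalGraph_le hbag hcover fun t => ?_, ?_, ?_, ?_⟩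
  · refine finite_of_atoms_subset (Finset.univ.biUnion bag) fun r hr a ha => ?_
    obtain ⟨t, ht⟩ := hcover r hr
    exact Finset.mem_coe.2 (Finset.mem_biUnion.2 ⟨t, Finset.mem_univ t, ht ha⟩)
  · refine (Finset.card_union_le _ _).trans ?_
    have h1 := (Finset.card_image_le (s := scope t) (f := (e · true))).trans (hm t)
    have h2 := (Finset.card_image_le (s := scope t) (f := (e · false))).trans (hm t)
    omega
  · intro I hI
    obtain ⟨X, hXW, hX, rfl⟩ := exists_eq_encode hinj hloc hI
    beta_reduce
    rw [hF X hXW]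
    exact h𝒮.mapsTo ⟨hXW, hX⟩
  · intro I hI I' hI' heq
    obtain ⟨X, hXW, hX, rfl⟩ := exists_eq_encode hinj hloc hI
    obtain ⟨Y, hYW, hY, rfl⟩ := exists_eq_encode hinj hloc hI'
    beta_reduce at heq
    rw [hF X hXW, hF Y hYW] at heq
    rw [h𝒮.injOn ⟨hXW, hX⟩ ⟨hYW, hY⟩ heq]
  · intro I hI
    obtain ⟨X, ⟨hXW, hX⟩, rfl⟩ := h𝒮.surjOn hI
    exact ⟨encode e scope X, isAnswerSet_encode hinj hloc hX, hF X hXW⟩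

end Program

/-! ### The variables and local constraints describing canonical level mappings. -/

theorem Rule.satisfied_congr {α : Type*} {r : Rule α} {I J : Set α}
    (h : ∀ a ∈ r.atoms, a ∈ I ↔ a ∈ J) (hr : r.Satisfied I) : r.Satisfied J := by
  rcases hr with ⟨a, ha, haI⟩ | ⟨a, ha, haI⟩
  · have hmem : a ∈ r.atoms := ha.elim (fun h => Or.inl (Or.inl h)) Or.inr
    exact Or.inl ⟨a, ha, (h a hmem).1 haI⟩
  · exact Or.inr ⟨a, ha, fun haJ => haI ((h a (Or.inl (Or.inr ha))).2 haJ)⟩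

namespace Program

variable {α : Type*} {N : Type}

theorem Supports.congr {P : Program α} {I J : Set α} {a : α} {r : Rule α}
    (h : ∀ a ∈ r.atoms, a ∈ I ↔ a ∈ J) (hr : P.Supports I a r) : P.Supports J a r where
  mem := hr.mem
  mem_head := hr.mem_head
  pos_subset := fun b hb => (h b (Or.inl (Or.inr hb))).1 (hr.pos_subset hb)
  neg_inter := by
    have := hr.neg_inter
    rw [Set.eq_empty_iff_forall_notMem] at this ⊢
    exact fun b hb => this b ⟨hb.1, (h b (Or.inr hb.1)).2 hb.2⟩
  eq_of_mem_head := fun b hb hbJ =>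
    hr.eq_of_mem_head b hb ((h b (Or.inl (Or.inl hb))).2 hbJ)

/-- The atom `a` is proven by a rule over the atoms `K`. -/
def Proves (P : Program α) (I : Set α) (lev : α → ℕ) (K : Finset α) (a : α) : Prop :=
  ∃ r, r.atoms ⊆ (K : Set α) ∧ P.Supports I a r ∧ ∀ b ∈ r.pos, P.DepPath a b → lev b < lev a

theorem Proves.congr {P : Program α} {I J : Set α} {lev lev' : α → ℕ} {K : Finset α} {a : α}
    (hI : ∀ b ∈ K, b ∈ I ↔ b ∈ J) (hlev : ∀ b ∈ K, lev b = lev' b)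
    (h : P.Proves I lev K a) : P.Proves J lev' K a := by
  obtain ⟨r, hr, hs, hlt⟩ := h
  refine ⟨r, hr, hs.congr fun b hb => hI b (hr hb), fun b hb hab => ?_⟩
  rw [← hlev b (hr (Or.inl (Or.inr hb))), ← hlev a (hr (Or.inl (Or.inl hs.mem_head)))]
  exact hlt b hb hab

/-- The atom `a` is proven at `t` or at a descendant of `t` within the subtree of `a`. -/
inductive ProvenBelow (P : Program α) (T : ParentTree N) (bag : N → Finset α) (I : Set α)
    (lev : α → ℕ) : N → α → Prop
  | base {t : N} {a : α} : P.Proves I lev (bag t) a → ProvenBelow P T bag I lev t a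
  | step {t c : N} {a : α} : c ∈ T.children t → a ∈ bag c → ProvenBelow P T bag I lev c a →
      ProvenBelow P T bag I lev t a

/-- The Boolean variables of the reduction: the given atoms, the bits of their levels, and for each
node the information whether an atom is proven below that node. -/
inductive Var (α : Type*) (N : Type)
  | atom (a : α)
  | bit (a : α) (i : ℕ)
  | proof (t : N) (a : α)

namespace Var

/-- The interpretation given by an assignment. -/
def interp (X : Set (Var α N)) : Set α := {a | atom a ∈ X}

open Classical in
/-- The levels, with `L` bits, given by an assignment. -/
noncomputable def level (L : ℕ) (X : Set (Var α N)) (a : α) : ℕ :=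
  ∑ i ∈ (Finset.range L).filter (fun i => bit a i ∈ X), 2 ^ i

theorem bit_mem_iff_of_level_eq {L : ℕ} {X Y : Set (Var α N)} {a : α}
    (h : level L X a = level L Y a) {i : ℕ} (hi : i < L) : bit a i ∈ X ↔ bit a i ∈ Y := by
  classical
  have h1 := congrArg (fun n => n.bitIndices.toFinset) h
  simp only [level, Finset.toFinset_bitIndices_sum_two_pow] at h1
  have h2 := Finset.ext_iff.1 h1 i
  simpa [hi] using h2

theorem level_congr {L : ℕ} {X Y : Set (Var α N)} {a : α}
    (h : ∀ i < L, bit a i ∈ X ↔ bit a i ∈ Y) : level L X a = level L Y a := by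
  classical
  unfold level
  congr 1
  exact Finset.filter_congr fun i hi => h i (Finset.mem_range.1 hi)

theorem level_eq_zero {L : ℕ} {X : Set (Var α N)} {a : α} (h : ∀ i, bit a i ∉ X) :
    level L X a = 0 := by
  simp [level, h]

theorem level_eq {L : ℕ} {X : Set (Var α N)} {a : α} {n : ℕ} (hn : n < 2 ^ L)
    (h : ∀ i, bit a i ∈ X ↔ i ∈ n.bitIndices) : level L X a = n := by
  classical
  have : (Finset.range L).filter (fun i => bit a i ∈ X) = n.bitIndices.toFinset := by
    ext i
    rw [Finset.mem_filter, h, Finset.mem_range, List.mem_toFinset, and_iff_right_iff_imp]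
    intro hi
    exact (Nat.pow_lt_pow_iff_right one_lt_two).1
      ((Nat.two_pow_le_of_mem_bitIndices hi).trans_lt hn)
  rw [level, this, Finset.sum_toFinset_bitIndices_two_pow]

open Classical in
/-- The variables constrained at a node. -/
noncomputable def scope [Finite N] (T : ParentTree N) (bag : N → Finset α) (L : ℕ) (t : N) :
    Finset (Var α N) :=
  (bag t).image atom ∪ (bag t ×ˢ Finset.range L).image (fun p => bit p.1 p.2) ∪
    (bag t).image (proof t) ∪
    (Set.toFinite (T.children t)).toFinset.biUnion fun c => (bag c).image (proof c)

section scope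

variable [Finite N] {T : ParentTree N} {bag : N → Finset α} {L : ℕ} {t : N}

theorem atom_mem_scope {a : α} : atom a ∈ scope T bag L t ↔ a ∈ bag t := by
  simp [scope]

theorem bit_mem_scope {a : α} {i : ℕ} : bit a i ∈ scope T bag L t ↔ a ∈ bag t ∧ i < L := by
  simp [scope]

theorem proof_mem_scope {a : α} {c : N} :
    proof c a ∈ scope T bag L t ↔ a ∈ bag c ∧ (c = t ∨ c ∈ T.children t) := by
  simp only [scope, Finset.mem_union, Finset.mem_image, Finset.mem_biUnion, reduceCtorEq,
    and_false, exists_false, false_or, proof.injEq, Set.Finite.mem_toFinset]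
  constructor
  · rintro (⟨b, hb, rfl, rfl⟩ | ⟨d, hd, b, hb, rfl, rfl⟩)
    exacts [⟨hb, Or.inl rfl⟩, ⟨hb, Or.inr hd⟩]
  · rintro ⟨ha, rfl | hc⟩
    exacts [Or.inl ⟨a, ha, rfl, rfl⟩, Or.inr ⟨c, hc, a, ha, rfl, rfl⟩]

/-- Atoms and bits inherit the subtrees of `bag`. A variable `proof c a` occurs only at `c` and its
parent, so its top node is that parent, or `c` itself at the root. -/
theorem isDecomposition_scope (hB : T.IsDecomposition bag) :
    T.IsDecomposition (scope T bag L) := by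
  rintro (a | ⟨a, i⟩ | ⟨c, a⟩) t ht
  · rw [atom_mem_scope] at ht
    obtain ⟨τ, hτ, h⟩ := hB a t ht
    exact ⟨τ, atom_mem_scope.2 hτ, fun s hs hne =>
      (h s (atom_mem_scope.1 hs) hne).imp id atom_mem_scope.2⟩
  · rw [bit_mem_scope] at ht
    obtain ⟨τ, hτ, h⟩ := hB a t ht.1
    exact ⟨τ, bit_mem_scope.2 ⟨hτ, ht.2⟩, fun s hs hne =>
      (h s (bit_mem_scope.1 hs).1 hne).imp id fun h => bit_mem_scope.2 ⟨h, ht.2⟩⟩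
  · rw [proof_mem_scope] at ht
    by_cases hc : c = T.root
    · refine ⟨c, proof_mem_scope.2 ⟨ht.1, Or.inl rfl⟩, fun s hs hne => ?_⟩
      rcases (proof_mem_scope.1 hs).2 with rfl | h
      exacts [absurd rfl hne, absurd hc h.1]
    · refine ⟨T.parent c, proof_mem_scope.2 ⟨ht.1, Or.inr ⟨hc, rfl⟩⟩, fun s hs hne => ?_⟩
      rcases (proof_mem_scope.1 hs).2 with rfl | h
      · exact ⟨hc, proof_mem_scope.2 ⟨ht.1, Or.inr ⟨hc, rfl⟩⟩⟩
      · exact absurd h.2.symm hne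

/-- At most `m` atoms, `m * L` bits, `m` proof variables of the node and `2 * m` of its children. -/
theorem card_scope_le {m : ℕ} (hm : ∀ t, (bag t).card ≤ m) (hT : (T.children t).ncard ≤ 2) :
    (scope T bag L t).card ≤ m * (L + 4) := by
  classical
  have h1 : ((bag t).image (atom (N := N))).card ≤ m := Finset.card_image_le.trans (hm t)
  have h2 : ((bag t ×ˢ Finset.range L).image
      (fun p => (bit p.1 p.2 : Var α N))).card ≤ m * L := by
    refine Finset.card_image_le.trans ?_
    rw [Finset.card_product, Finset.card_range]
    exact Nat.mul_le_mul_right L (hm t)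
  have h3 : ((bag t).image (proof t)).card ≤ m := Finset.card_image_le.trans (hm t)
  have h4 : ((Set.toFinite (T.children t)).toFinset.biUnion
      fun c => (bag c).image (proof c)).card ≤ 2 * m := by
    refine (Finset.card_biUnion_le_card_mul _ _ m fun c _ =>
      Finset.card_image_le.trans (hm c)).trans (Nat.mul_le_mul_right m ?_)
    rwa [← Set.ncard_eq_toFinset_card]
  unfold scope
  refine (Finset.card_union_le _ _).trans ?_
  refine (Nat.add_le_add ((Finset.card_union_le _ _).trans
    (Nat.add_le_add (Finset.card_union_le _ _) le_rfl)) le_rfl).trans ?_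
  rw [mul_add]
  omega

end scope

/-- The constraints on an assignment at a node. -/
structure IsConsistent (P : Program α) (T : ParentTree N) (bag : N → Finset α) (L : ℕ) (t : N)
    (X : Set (Var α N)) : Prop where
  satisfied : ∀ r ∈ P, r.atoms ⊆ (bag t : Set α) → r.Satisfied (interp X)
  eq_zero : ∀ a ∈ bag t, a ∉ interp X → level L X a = 0
  upper : ∀ r, r.atoms ⊆ (bag t : Set α) → ∀ a, P.Supports (interp X) a r →
    a ∈ interp X → level L X a = 0 ∨ ∃ b ∈ r.pos, P.DepPath a b ∧ level L X a ≤ level L X b + 1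
  proof_iff : ∀ a ∈ bag t, proof t a ∈ X ↔ P.Proves (interp X) (level L X) (bag t) a ∨
    ∃ c ∈ T.children t, a ∈ bag c ∧ proof c a ∈ X
  proven : ∀ a ∈ bag t, a ∈ interp X → (t = T.root ∨ a ∉ bag (T.parent t)) → proof t a ∈ X

/-- Locality: everything the constraints at `t` inspect, including the proof variables of children,
belongs to the scope of `t`. -/
theorem IsConsistent.congr [Finite N] {P : Program α} {T : ParentTree N} {bag : N → Finset α}
    {L : ℕ} (t : N) (X Y : Set (Var α N)) (h : ∀ s ∈ scope T bag L t, s ∈ X ↔ s ∈ Y)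
    (hX : IsConsistent P T bag L t X) : IsConsistent P T bag L t Y := by
  have hI : ∀ a ∈ bag t, a ∈ interp X ↔ a ∈ interp Y := fun a ha => h _ (atom_mem_scope.2 ha)
  have hlev : ∀ a ∈ bag t, level L X a = level L Y a := fun a ha =>
    level_congr fun i hi => h _ (bit_mem_scope.2 ⟨ha, hi⟩)
  have hpf : ∀ a ∈ bag t, proof t a ∈ X ↔ proof t a ∈ Y := fun a ha =>
    h _ (proof_mem_scope.2 ⟨ha, Or.inl rfl⟩)
  have hpc : ∀ c ∈ T.children t, ∀ a ∈ bag c, proof c a ∈ X ↔ proof c a ∈ Y := fun c hc a ha =>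
    h _ (proof_mem_scope.2 ⟨ha, Or.inr hc⟩)
  refine ⟨fun r hr hsub => ?_, fun a ha haY => ?_, fun r hsub a hs haY => ?_, fun a ha => ?_,
    fun a ha haY htop => ?_⟩
  · exact Rule.satisfied_congr (fun a ha => hI a (hsub ha)) (hX.satisfied r hr hsub)
  · rw [← hlev a ha]
    exact hX.eq_zero a ha fun h => haY ((hI a ha).1 h)
  · have ha : a ∈ bag t := hsub (Or.inl (Or.inl hs.mem_head))
    rcases hX.upper r hsub a (hs.congr fun b hb => (hI b (hsub hb)).symm) ((hI a ha).2 haY) with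
      h0 | ⟨b, hb, hab, hle⟩
    · exact Or.inl (hlev a ha ▸ h0)
    · refine Or.inr ⟨b, hb, hab, ?_⟩
      rw [← hlev a ha, ← hlev b (hsub (Or.inl (Or.inr hb)))]
      exact hle
  · rw [← hpf a ha, hX.proof_iff a ha]
    refine or_congr ⟨fun h => h.congr hI hlev, fun h => h.congr (fun b hb => (hI b hb).symm)
      fun b hb => (hlev b hb).symm⟩ ?_
    exact exists_congr fun c => and_congr_right fun hc => and_congr_right fun hac => hpc c hc a hac
  · exact (hpf a ha).1 (hX.proven a ha ((hI a ha).2 haY) htop)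

/-- Every node on the way from `s` up to `τ` contains `a`, so the proof can be handed to the parent
at each step. -/
theorem provenBelow_top {P : Program α} {T : ParentTree N} {bag : N → Finset α} {I : Set α} {lev : α → ℕ} {a : α} {τ : N}
    (hτ : ∀ s, a ∈ bag s → s ≠ τ → s ≠ T.root ∧ a ∈ bag (T.parent s)) (s : N) :
    a ∈ bag s → P.ProvenBelow T bag I lev s a → P.ProvenBelow T bag I lev τ a := by
  induction s using T.induction_down with
  | _ s ih =>
    intro hs h
    by_cases hne : s = τ
    · rwa [← hne]
    · obtain ⟨h1, h2⟩ := hτ s hs hne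
      exact ih h1 h2 (.step ⟨h1, rfl⟩ hs h)

section solutions

variable [Finite N] {P : Program α} {T : ParentTree N} {bag : N → Finset α} {L : ℕ}

/-- A proof variable cannot justify itself: it refers only to children, so in a finite tree the
references end at an actual proving rule. -/
theorem exists_proves_of_proof_mem {X : Set (Var α N)}
    (hX : ∀ t, IsConsistent P T bag L t X) (t : N) :
    ∀ a ∈ bag t, proof t a ∈ X → ∃ s, P.Proves (interp X) (level L X) (bag s) a := by
  induction t using T.induction_up with
  | _ t ih =>
    intro a ha h
    rcases ((hX t).proof_iff a ha).1 h with h | ⟨c, hc, hac, h⟩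
    · exact ⟨t, h⟩
    · exact ih c hc a hac h

/-- An assignment satisfying all constraints encodes the canonical level mapping of a model. -/
theorem isLevelling_of_isConsistent (hB : T.IsDecomposition bag)
    (hcov : ∀ r ∈ P, ∃ t, r.atoms ⊆ (bag t : Set α)) {X : Set (Var α N)}
    (hXs : ∀ s ∈ X, ∃ t, s ∈ scope T bag L t) (hX : ∀ t, IsConsistent P T bag L t X) :
    P.IsModel (interp X) ∧ P.IsLevelling (interp X) (level L X) := by
  refine ⟨fun r hr => ?_, fun a ha => ?_, fun a ha r hr => ?_, fun a ha => ?_⟩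
  · obtain ⟨t, ht⟩ := hcov r hr
    exact (hX t).satisfied r hr ht
  · by_cases h : ∃ t, a ∈ bag t
    · obtain ⟨t, ht⟩ := h
      exact (hX t).eq_zero a ht ha
    · refine level_eq_zero fun i hi => h ?_
      obtain ⟨t, ht⟩ := hXs _ hi
      exact ⟨t, (bit_mem_scope.1 ht).1⟩
  · obtain ⟨t, ht⟩ := hcov r hr.mem
    exact (hX t).upper r ht a hr ha
  · obtain ⟨t, ht⟩ := hXs _ ha
    obtain ⟨τ, hτ, htop, -⟩ := hB.exists_top (atom_mem_scope.1 ht)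
    obtain ⟨s, r, -, hr, hlt⟩ :=
      exists_proves_of_proof_mem hX τ a hτ ((hX τ).proven a hτ ha htop)
    exact ⟨r, hr, hlt⟩

/-- The equivalence `proof_iff` determines the proof variables from the leaves upwards, given
interpretation and levels. -/
theorem proof_mem_of_isConsistent {X Y : Set (Var α N)}
    (hX : ∀ t, IsConsistent P T bag L t X) (hY : ∀ t, IsConsistent P T bag L t Y)
    (hI : interp X = interp Y) (hlev : level L X = level L Y) (t : N) :
    ∀ a ∈ bag t, proof t a ∈ X → proof t a ∈ Y := by
  induction t using T.induction_up with
  | _ t ih =>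
    intro a ha h
    rcases ((hX t).proof_iff a ha).1 h with h | ⟨c, hc, hac, h⟩
    · exact ((hY t).proof_iff a ha).2 (Or.inl (hI ▸ hlev ▸ h))
    · exact ((hY t).proof_iff a ha).2 (Or.inr ⟨c, hc, hac, ih c hc a hac h⟩)

/-- Injectivity of the projection: the interpretation fixes the canonical levels, binary expansions
fix the bits, and both together fix the proof variables. -/
theorem subset_of_isConsistent (hB : T.IsDecomposition bag)
    (hcov : ∀ r ∈ P, ∃ t, r.atoms ⊆ (bag t : Set α)) {X Y : Set (Var α N)}
    (hXs : ∀ s ∈ X, ∃ t, s ∈ scope T bag L t) (hX : ∀ t, IsConsistent P T bag L t X)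
    (hYs : ∀ s ∈ Y, ∃ t, s ∈ scope T bag L t) (hY : ∀ t, IsConsistent P T bag L t Y)
    (hI : interp X = interp Y) : X ⊆ Y := by
  have hX' := (isLevelling_of_isConsistent hB hcov hXs hX).2
  have hY' := (isLevelling_of_isConsistent hB hcov hYs hY).2
  rw [← hI] at hY'
  have hlev := hX'.unique hY'
  rintro (a | ⟨a, i⟩ | ⟨t, a⟩) h
  · exact (Set.ext_iff.1 hI a).1 h
  · obtain ⟨t, ht⟩ := hXs _ h
    exact (bit_mem_iff_of_level_eq (congrFun hlev a) (bit_mem_scope.1 ht).2).1 h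
  · obtain ⟨s, hs⟩ := hXs _ h
    exact proof_mem_of_isConsistent hX hY hI hlev t a (proof_mem_scope.1 hs).1 h

/-- The assignment is forced: binary digits of the levels, and `ProvenBelow` for the proof
variables. `ProvenBelow` satisfies `proof_iff` by case analysis on its two constructors. -/
theorem exists_isConsistent (hB : T.IsDecomposition bag)
    (hcov : ∀ r ∈ P, ∃ t, r.atoms ⊆ (bag t : Set α)) {I : Set α} (hI : P.IsModel I)
    (hIP : I ⊆ P.atoms) {lev : α → ℕ} (hlev : P.IsLevelling I lev) (hL : ∀ a, lev a < 2 ^ L) :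
    ∃ X : Set (Var α N), (∀ s ∈ X, ∃ t, s ∈ scope T bag L t) ∧
      (∀ t, IsConsistent P T bag L t X) ∧ interp X = I := by
  have hbag : ∀ a ∈ I, ∃ t, a ∈ bag t := by
    intro a ha
    obtain ⟨r, hr, har⟩ := mem_atoms.1 (hIP ha)
    obtain ⟨t, ht⟩ := hcov r hr
    exact ⟨t, ht har⟩
  let X : Set (Var α N) := {s | match s with
    | atom a => a ∈ I
    | bit a i => i ∈ (lev a).bitIndices
    | proof t a => a ∈ bag t ∧ P.ProvenBelow T bag I lev t a}
  have hXI : interp X = I := rfl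
  have hXlev : level L X = lev := funext fun a => level_eq (hL a) fun i => Iff.rfl
  refine ⟨X, ?_, fun t => ⟨?_, ?_, ?_, ?_, ?_⟩, hXI⟩
  · rintro (a | ⟨a, i⟩ | ⟨t, a⟩) h
    · obtain ⟨t, ht⟩ := hbag a h
      exact ⟨t, atom_mem_scope.2 ht⟩
    · have h' : i ∈ (lev a).bitIndices := h
      have ha : a ∈ I := by
        by_contra ha
        rw [hlev.eq_zero a ha] at h'
        simp at h'
      obtain ⟨t, ht⟩ := hbag a ha
      exact ⟨t, bit_mem_scope.2 ⟨ht, (Nat.pow_lt_pow_iff_right one_lt_two).1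
        ((Nat.two_pow_le_of_mem_bitIndices h').trans_lt (hL a))⟩⟩
    · exact ⟨t, proof_mem_scope.2 ⟨h.1, Or.inl rfl⟩⟩
  · exact fun r hr _ => hI r hr
  · intro a _ ha
    rw [hXlev]
    exact hlev.eq_zero a ha
  · intro r _ a hr ha
    rw [hXlev]
    exact hlev.upper a ha r hr
  · intro a ha
    rw [hXI, hXlev]
    constructor
    · rintro ⟨-, h⟩
      cases h with
      | base h => exact Or.inl h
      | step hc hac h => exact Or.inr ⟨_, hc, hac, hac, h⟩
    · rintro (h | ⟨c, hc, hac, -, h⟩)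
      exacts [⟨ha, .base h⟩, ⟨ha, .step hc hac h⟩]
  · intro a ha haI htop
    refine ⟨ha, ?_⟩
    obtain ⟨r, hr, hlt⟩ := hlev.proven a haI
    obtain ⟨s, hs⟩ := hcov r hr.mem
    obtain ⟨τ, -, -, hτ⟩ := hB.exists_top ha
    -- A node containing `a` that is the root or whose parent omits `a` must be the top node of `a`.
    have hτt : t = τ := by
      by_contra hne
      obtain ⟨h1, h2⟩ := hτ t ha hne
      exact htop.elim h1 fun h => h h2
    subst hτt
    exact provenBelow_top hτ s (hs (Or.inl (Or.inl hr.mem_head))) (.base ⟨r, hs, hr, hlt⟩)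

theorem bijOn_isConsistent (hP : P.Finite) (hHCF : P.IsHCF) (hB : T.IsDecomposition bag)
    (hcov : ∀ r ∈ P, ∃ t, r.atoms ⊆ (bag t : Set α)) (hbag : ∀ t, (bag t : Set α) ⊆ P.atoms)
    (hL : ∀ C, P.IsSCC C → C.ncard + 1 ≤ 2 ^ L) :
    Set.BijOn (fun X => {a | a ∈ P.atoms ∧ atom a ∈ X})
      {X : Set (Var α N) | (∀ s ∈ X, ∃ t, s ∈ scope T bag L t) ∧
        ∀ t, IsConsistent P T bag L t X} {I | P.IsAnswerSet I} := by
  have hF : ∀ X : Set (Var α N), (∀ s ∈ X, ∃ t, s ∈ scope T bag L t) →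
      {a | a ∈ P.atoms ∧ atom a ∈ X} = interp X := by
    intro X hX
    refine Set.Subset.antisymm (fun a ha => ha.2) fun a ha => ⟨?_, ha⟩
    obtain ⟨t, ht⟩ := hX _ ha
    exact hbag t (atom_mem_scope.1 ht)
  refine ⟨?_, ?_, ?_⟩
  · rintro X ⟨hXs, hX⟩
    beta_reduce
    rw [hF X hXs]
    obtain ⟨h1, h2⟩ := isLevelling_of_isConsistent hB hcov hXs hX
    exact h2.isAnswerSet hP h1
  · rintro X ⟨hXs, hX⟩ Y ⟨hYs, hY⟩ heq
    beta_reduce at heq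
    rw [hF X hXs, hF Y hYs] at heq
    exact (subset_of_isConsistent hB hcov hXs hX hYs hY heq).antisymm
      (subset_of_isConsistent hB hcov hYs hY hXs hX heq.symm)
  · intro I hI
    obtain ⟨lev, hlev⟩ := hI.exists_isLevelling hHCF
    obtain ⟨X, hXs, hX, rfl⟩ := exists_isConsistent (L := L) hB hcov (isAnswerSet_iff.1 hI).1
      hI.subset_atoms hlev fun a => by
        by_cases ha : a ∈ I
        · exact hlev.lt_of_isSCC_bound hP hL ha
        · rw [hlev.eq_zero a ha]
          positivity
    exact ⟨X, ⟨hXs, hX⟩, hF X hXs⟩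

end solutions

end Var

/-! ### Assembling the reduction, and degenerate parameters. -/

/-- Removing cyclicity with `L` bits per level. -/
theorem exists_isTight_of_isHCF [Infinite α] {P : Program α} (hP : P.Finite) (hHCF : P.IsHCF)
    {k L : ℕ} (hk : treewidth P.primalGraph ≤ k)
    (hL : ∀ C, P.IsSCC C → C.ncard + 1 ≤ 2 ^ L) :
    ∃ Q : Program α, Q.Finite ∧ Q.IsTight ∧
      treewidth Q.primalGraph ≤ ((2 * (2 * (k + 1) * (L + 4)) : ℕ) : ℤ) - 1 ∧
      Set.BijOn (fun I => I ∩ P.atoms) {I | Q.IsAnswerSet I} {I | P.IsAnswerSet I} := by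
  obtain ⟨N, hN, T₀, bag₀, hB₀, hcov₀, hcard₀, hbag₀⟩ := exists_isDecomposition hP hk
  obtain ⟨T, bag, hB, hsub, hsub', hcard, hchild⟩ := hB₀.exists_binary hcard₀
  have hcov : ∀ r ∈ P, ∃ t, r.atoms ⊆ (bag t : Set α) := fun r hr => by
    obtain ⟨t, ht⟩ := hcov₀ r hr
    exact ⟨t, ht.trans (Finset.coe_subset.2 (hsub t))⟩
  have hbag : ∀ t, (bag t : Set α) ⊆ P.atoms := fun t a ha => by
    obtain ⟨s, hs⟩ := hsub' t a ha
    exact hbag₀ s hs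
  -- Bags of size `k + 1` double under binarisation, grow by the factor `L + 4` for the variables
  -- per atom, and double again for the literals.
  exact exists_isTight_of_constraints (Var.isDecomposition_scope hB)
    (fun t => Var.card_scope_le hcard (hchild t)) Var.IsConsistent.congr (finite_atoms hP)
    Var.atom (fun _ _ h => Var.atom.inj h) (Var.bijOn_isConsistent hP hHCF hB hcov hbag hL)

theorem bijOn_inter_atoms (P : Program α) :
    Set.BijOn (fun I => I ∩ P.atoms) {I | P.IsAnswerSet I} {I | P.IsAnswerSet I} :=
  (Set.bijOn_id _).congr fun _ hI => (Set.inter_eq_left.2 (IsAnswerSet.subset_atoms hI)).symm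

/-- A finite program whose primal graph has no edges is tight. -/
theorem isTight_of_treewidth_le_zero {P : Program α} (hP : P.Finite)
    (h : treewidth P.primalGraph ≤ 0) : P.IsTight := by
  obtain ⟨N, hN, T, bag, hB, hcov, hcard, -⟩ := exists_isDecomposition (k := 0) hP (by simpa using h)
  intro a ha
  obtain ⟨b, ⟨r, hr, har, hbr⟩, -⟩ := Relation.TransGen.head'_iff.1 ha
  obtain ⟨t, ht⟩ := hcov r hr
  have hab : a = b := Finset.card_le_one.1 (hcard t) a (ht (Or.inl (Or.inr har))) b
    (ht (Or.inl (Or.inl hbr)))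
  subst hab
  exact Finset.disjoint_left.1 r.head_pos hbr har

/-- If no atom occurs in a head or a positive body, then only the empty program has an answer
set. -/
theorem eq_empty_of_isAnswerSet {P : Program α} (h : P.depVertices = ∅) {I : Set α}
    (hI : P.IsAnswerSet I) : P = ∅ := by
  have hhead : ∀ r ∈ P, ∀ a, a ∉ r.head := fun r hr a ha =>
    Set.notMem_empty a (h ▸ mem_depVertices_of_mem_head hr ha)
  have hpos : ∀ r ∈ P, (r.pos : Set α) = ∅ := fun r hr =>
    Set.eq_empty_of_forall_notMem fun a ha =>
      Set.notMem_empty a (h ▸ Set.mem_biUnion hr (Or.inr ha))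
  rw [isAnswerSet_iff, ← isModel_reduct_self_iff] at hI
  obtain ⟨hm, hmin⟩ := hI
  rw [isModel_reduct_iff] at hm
  have hneg : ∀ r ∈ P, (r.neg : Set α) ∩ I ≠ ∅ := fun r hr hn => by
    obtain ⟨a, ha, -⟩ := hm r hr hn (by simp [hpos r hr])
    exact hhead r hr a ha
  have hIe : I ⊆ ∅ := hmin ∅ (Set.empty_subset _)
    (isModel_reduct_iff.2 fun r hr hn => absurd hn (hneg r hr))
  refine Set.eq_empty_of_forall_notMem fun r hr => hneg r hr ?_
  rw [Set.subset_empty_iff.1 hIe, Set.inter_empty]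

/-- `P` itself may have large treewidth through negative bodies, so it is replaced by a program
without atoms: the empty one, or, if `P` is non-empty and thus has no answer set, the single rule
with empty head and body. -/
theorem exists_isTight_of_depVertices_eq_empty {P : Program α} (h : P.depVertices = ∅) :
    ∃ Q : Program α, Q.Finite ∧ Q.IsTight ∧ treewidth Q.primalGraph ≤ 0 ∧
      Set.BijOn (fun I => I ∩ P.atoms) {I | Q.IsAnswerSet I} {I | P.IsAnswerSet I} := by
  have key : ∀ Q : Program α, (∀ r ∈ Q, r.atoms = ∅) →
      Q.depVertices = ∅ ∧ Q.IsTight ∧ treewidth Q.primalGraph ≤ 0 := by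
    intro Q hQ
    have hdep : Q.depVertices = ∅ := by
      refine Set.subset_empty_iff.1 (Q.depVertices_subset_atoms.trans fun a ha => ?_)
      obtain ⟨r, hr, har⟩ := mem_atoms.1 ha
      exact hQ r hr ▸ har
    refine ⟨hdep, fun a ha => ?_, ?_⟩
    · exact Set.notMem_empty a (hdep ▸ ha.mem_depVertices.1)
    · let T : ParentTree Unit := ⟨(), id, fun _ => 0, fun t ht => absurd rfl ht⟩
      refine (treewidth_primalGraph_le (T := T) (bag := fun _ => ∅) (m := 0)
        (fun v t hv => absurd hv (Finset.notMem_empty v)) (fun r hr => ⟨(), ?_⟩) (by simp)).trans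
        (by norm_num)
      rw [hQ r hr]
      exact Set.empty_subset _
  rcases P.eq_empty_or_nonempty with rfl | hne
  · exact ⟨∅, Set.finite_empty, (key ∅ (by simp)).2.1, (key ∅ (by simp)).2.2, bijOn_inter_atoms ∅⟩
  · let r : Rule α := ⟨∅, ∅, ∅, by simp, by simp, by simp⟩
    obtain ⟨h1, h2, h3⟩ := key {r} (by simp [r, Rule.atoms])
    have hQ : {I | ({r} : Program α).IsAnswerSet I} = ∅ :=
      Set.eq_empty_of_forall_notMem fun I hI =>
        (Set.singleton_nonempty r).ne_empty (eq_empty_of_isAnswerSet h1 hI)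
    have hP : {I | P.IsAnswerSet I} = ∅ :=
      Set.eq_empty_of_forall_notMem fun I hI => hne.ne_empty (eq_empty_of_isAnswerSet h hI)
    exact ⟨{r}, Set.finite_singleton r, h2, h3, by rw [hQ, hP]; exact Set.bijOn_empty _⟩

end Program

theorem mainTheorem2 :
    ∃ c : ℝ, ∀ (α : Type*) [Infinite α] (P : Program α) (k ℓ : ℕ),
      P.Finite → P.IsHCF →
      treewidth P.primalGraph ≤ (k : ℤ) →
      (∀ C : Set α, P.IsSCC C → C.ncard + 1 ≤ ℓ) →
      ∃ P' : Program α, P'.Finite ∧ P'.IsTight ∧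
        (treewidth P'.primalGraph : ℝ) ≤ c * (k * Real.logb 2 ℓ) ∧
        Set.BijOn (fun I' => I' ∩ P.atoms)
          {I' | P'.IsAnswerSet I'} {I | P.IsAnswerSet I} := by
  -- The constant is 2 · 2 · 2 · 6: the two doublings, `k + 1 ≤ 2 * k`, and `clog + 4 ≤ log + 5 ≤ 6
  -- * log`. These estimates need `k ≥ 1` and `ℓ ≥ 2`; otherwise the claimed bound is zero and is
  -- treated separately.
  refine ⟨48, fun α _ P k ℓ hP hHCF hk hℓ => ?_⟩
  rcases Nat.lt_or_ge ℓ 2 with hℓ2 | hℓ2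
  -- Components are non-empty, so `ℓ < 2` leaves no room for any.
  · have hdep : P.depVertices = ∅ := by
      refine Set.eq_empty_of_forall_notMem fun a ha => ?_
      have h1 := hℓ _ (Program.isSCC_component ha)
      have h2 := (Set.ncard_pos (Program.finite_component hP a)).2 ⟨a, Or.inl rfl⟩
      omega
    obtain ⟨Q, h1, h2, h3, h4⟩ := Program.exists_isTight_of_depVertices_eq_empty hdep
    refine ⟨Q, h1, h2, ?_, h4⟩
    have hlog : Real.logb 2 ℓ = 0 := by
      interval_cases ℓ <;> simp
    rw [hlog, mul_zero, mul_zero]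
    exact_mod_cast h3
  rcases Nat.eq_zero_or_pos k with rfl | hk0
  -- With `k = 0` the program is already tight and serves as its own translation.
  · refine ⟨P, hP, Program.isTight_of_treewidth_le_zero hP (by simpa using hk), ?_,
      P.bijOn_inter_atoms⟩
    rw [Nat.cast_zero, zero_mul, mul_zero]
    exact_mod_cast hk
  obtain ⟨Q, h1, h2, h3, h4⟩ := Program.exists_isTight_of_isHCF hP hHCF (L := Nat.clog 2 ℓ) hk
    fun C hC => (hℓ C hC).trans (Nat.le_pow_clog one_lt_two ℓ)
  refine ⟨Q, h1, h2, ?_, h4⟩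
  have hlog : 1 ≤ Real.logb 2 ℓ := by
    rw [Real.le_logb_iff_rpow_le one_lt_two (by positivity), Real.rpow_one]
    exact_mod_cast hℓ2
  have hclog : (Nat.clog 2 ℓ : ℝ) ≤ Real.logb 2 ℓ + 1 := by
    have := Nat.ceil_lt_add_one (zero_le_one.trans hlog)
    rw [← Nat.cast_two, Real.natCeil_logb_natCast] at this
    exact_mod_cast this.le
  have h3' : (treewidth Q.primalGraph : ℝ) ≤ 2 * (2 * (k + 1) * (Nat.clog 2 ℓ + 4)) := by
    have h : treewidth Q.primalGraph ≤ ((2 * (2 * (k + 1) * (Nat.clog 2 ℓ + 4)) : ℕ) : ℤ) := by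
      omega
    exact_mod_cast h
  have hk1 : (1 : ℝ) ≤ k := by exact_mod_cast hk0
  calc (treewidth Q.primalGraph : ℝ) ≤ 2 * (2 * (k + 1) * (Nat.clog 2 ℓ + 4)) := h3'
    _ ≤ 2 * (2 * (k + k) * (6 * Real.logb 2 ℓ)) := by
      gcongr
      linarith
    _ = 48 * (k * Real.logb 2 ℓ) := by ring
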